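/- Let $\alpha_k=\lceil 2^k/k^2\rceil$ for $k\ge 1$. The bubble graph $S$ is the following graph, with edges labelled by $a^{\pm1},b^{\pm1}$. Its vertices are arranged in pairwise disjoint cycles, each having a level $k\ge1$. A cycle of level $k$ has length $2\alpha_k$, carries a distinguished starting vertex, and its middle vertex is the vertex opposite to the starting one; its edges are labelled cyclically by $a$. There is exactly one cycle of level $1$, whose starting vertex is the root $o$. For every cycle $C$ of level $k$ there are exactly two cycles $C',C''$ of level $k+1$ attached to it: the middle vertex of $C$ and the starting vertices of $C'$ and $C''$ form a $3$-cycle labelled cyclically by $b$. All cycles arise in this way, and $b$ fixes every vertex that lies on no such $3$-cycle. Thus $a$ and $b$ define permutations of the vertices of $S$; the bubble group $\Gamma$ is the group generated by them, acting on $S$ from the right, $(x,g)\mapsto x.g$. Let $$G=\mathbb{Z}_2\wr_S\Gamma=\Big(\bigoplus_S\mathbb{Z}_2\Big)\rtimes\Gamma,\qquad (f,g)(f',g')=(f+f'(\,\cdot\,.g),\,gg'),$$ be the permutational wreath product. Let $\mu$ be the law of the switch-walk-switch step $(\ell,1)(0,g)(\ell',1)$, where $g$ is uniform on $\{a,a^{-1},b,b^{-1}\}$,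 the configurations $\ell,\ell'$ vanish off $o$ and have uniform values in $\mathbb{Z}_2$ at $o$, and $g,\ell,\ell'$ are independent. Let $X_n$ be the product of $n$ independent elements of $G$ with law $\mu$ (with $X_0=e$), and put $p_n(e,e)=\mathbb{P}(X_n=e)$. **Theorem.** The group $G$ is finitely generated, $\mu$ is symmetric ($\mu(g^{-1})=\mu(g)$ for all $g\in G$) and finitely supported, and the support of $\mu$ generates $G$. Moreover: 1. $G$ is non-Liouville with respect to $\mu$: there is a nonconstant bounded function $f:G\to\mathbb{R}$ with $f(g)=\sum_{h\in G}f(gh)\mu(h)$ for all $g\in G$. 2. The random walk has positive speed: for the word length $|\cdot|_T$ of every finite generating set $T$ of $G$ there is $c>0$ such that $\mathbb{E}|X_n|_T\ge cn$ for all $n\ge 0$. 3. The upper return probability exponent satisfies $$\overline{\gamma}=\limsup_{n\to\infty}\frac{\log|\log p_{2n}(e,e)|}{\log n}\le\frac12 .$$ In particular there exist a finitely generated group and a symmetric, finitely supported random walk on it that is non-Liouville and has $\overline{\gamma}\le 1/2$. -/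

import Mathlib

noncomputable section

/-! ### Random walks on groups -/

namespace RandomWalk

variable {G : Type*} [Group G]

/-- The law of `X_n = h₁ h₂ ⋯ h_n`, where the `h_i` are independent with law `μ`
(so `X_0 = 1`); `law μ n g` is the `n`-step transition probability from `1` to `g`. -/
def law (μ : PMF G) : ℕ → PMF G
  | 0 => PMF.pure 1
  | n + 1 => (law μ n).bind fun g => μ.map fun h => g * h

/-- The return probability `p_n(e, e)`. -/
def returnProb (μ : PMF G) (n : ℕ) : ℝ := (law μ n 1).toReal

/-- The upper return probability exponent
`limsup_{n → ∞} log |log p_{2n}(e, e)| / log n`, as an extended real number. -/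
def upperReturnExponent (μ : PMF G) : EReal :=
  Filter.limsup
    (fun n : ℕ => ((Real.log |Real.log (returnProb μ (2 * n))| / Real.log n : ℝ) : EReal))
    Filter.atTop

/-- `f` is `μ`-harmonic: `f g = ∑_h f (g h) μ(h)`. -/
def IsHarmonic (μ : PMF G) (f : G → ℝ) : Prop :=
  ∀ g, f g = ∑' h, f (g * h) * (μ h).toReal

/-- The Liouville property with respect to `μ`: every bounded harmonic function is constant. -/
def Liouville (μ : PMF G) : Prop :=
  ∀ f : G → ℝ, (∃ C : ℝ, ∀ g, |f g| ≤ C) → IsHarmonic μ f → ∃ c : ℝ, ∀ g, f g = c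

/-- The word length of `g` with respect to `T ∪ T⁻¹`. -/
def wordLength (T : Set G) (g : G) : ℕ :=
  sInf {n | ∃ l : List G, l.length = n ∧ (∀ x ∈ l, x ∈ T ∨ x⁻¹ ∈ T) ∧ l.prod = g}

/-- Positive speed: the expected word length of `X_n` grows at least linearly in `n`, for the
word metric of every finite generating set. -/
def PositiveSpeed (μ : PMF G) : Prop :=
  ∀ T : Set G, T.Finite → Subgroup.closure T = ⊤ →
    ∃ c : ℝ, 0 < c ∧ ∀ n : ℕ, c * n ≤ ∑' g, (law μ n g).toReal * (wordLength T g : ℝ)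

end RandomWalk

/-! ### Permutational wreath products -/

namespace PermWreath

variable (A : Type*) [AddCommGroup A] (S : Type*) (Γ : Type*) [Group Γ] [MulAction Γ S]

/-- `Γ` acts on finitely supported configurations by `(g • f) x = f (g⁻¹ • x)`. -/
def lampAction : Γ →* MulAut (Multiplicative (S →₀ A)) where
  toFun g := AddEquiv.toMultiplicative (Finsupp.domCongr (MulAction.toPerm g : Equiv.Perm S))
  map_one' := by
    ext f x
    simp [Finsupp.domCongr, Finsupp.equivMapDomain_apply]
  map_mul' g h := by
    ext f x
    simp [Finsupp.domCongr, Finsupp.equivMapDomain_apply, mul_smul]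

end PermWreath

/-- The permutational wreath product `A ≀_S Γ = (⨁_S A) ⋊ Γ` for a commutative (additively
written) lamp group `A`. In terms of the right action `x.g = g⁻¹ • x` of `Γ` on `S`, the product
is `(f, g) (f', g') = (f + (x ↦ f' (x.g)), g g')`. -/
abbrev PermWreath (A : Type*) [AddCommGroup A] (S : Type*) (Γ : Type*) [Group Γ]
    [MulAction Γ S] : Type _ :=
  Multiplicative (S →₀ A) ⋊[PermWreath.lampAction A S Γ] Γ

namespace PermWreath

variable {A : Type*} [AddCommGroup A] {S : Type*} {Γ : Type*} [Group Γ] [MulAction Γ S]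

/-- The product rule, spelled out at a vertex. -/
theorem mul_left_apply (u v : PermWreath A S Γ) (x : S) :
    Multiplicative.toAdd (u * v).left x =
      Multiplicative.toAdd u.left x + Multiplicative.toAdd v.left (u.right⁻¹ • x) := by
  simp [lampAction, Finsupp.domCongr, Finsupp.equivMapDomain_apply, MulAction.toPerm]

/-- The switch at `o`: the element `(f, 1)` with `f o = l` and `f x = 0` for `x ≠ o`. -/
def switch (o : S) (l : A) : PermWreath A S Γ :=
  SemidirectProduct.inl (Multiplicative.ofAdd (Finsupp.single o l))

/-- One step `(l, 1) (0, g) (l', 1)` of the switch-walk-switch random walk: `l`, `l'` are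
independent switches at `o` with values of law `ν`, and `g` is independent of them with
law `μ`. -/
def switchWalkSwitch (o : S) (ν : PMF A) (μ : PMF Γ) : PMF (PermWreath A S Γ) :=
  ν.bind fun l => μ.bind fun g => ν.bind fun l' =>
    PMF.pure (switch o l * SemidirectProduct.inr g * switch o l')

end PermWreath

/-! ### Bubble graphs and bubble groups -/

namespace Bubble

/-- The vertices of the graph `S(α)`. The cycles of level `k ≥ 1` are indexed by the words `w`
of length `k - 1` in two letters (the two cycles of level `k + 1` attached to the cycle `w` are
`false :: w` and `true :: w`), and the cycle `w` consists of the points `⟨w, i⟩` with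
`i ∈ ℤ / 2 α_k`. Its starting point is `⟨w, 0⟩` and its middle point is `⟨w, α_k⟩`. -/
abbrev Vertex (α : ℕ → ℕ) : Type :=
  Σ w : List Bool, ZMod (2 * α (w.length + 1))

variable (α : ℕ → ℕ)

/-- The root, i.e. the starting point of the cycle of the first level. -/
def root : Vertex α := ⟨[], 0⟩

/-- The starting point of the cycle `w`. -/
def start (w : List Bool) : Vertex α := ⟨w, 0⟩

/-- The middle point of the cycle `w`. -/
def middle (w : List Bool) : Vertex α := ⟨w, (α (w.length + 1) : ZMod _)⟩

/-- The generator `a` moves every vertex to the next one on its cycle. -/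
def a : Equiv.Perm (Vertex α) :=
  Equiv.sigmaCongrRight fun _ => Equiv.addRight 1

/-- The map given by `b`: it runs cyclically through the branching cycles
`middle w → start (false :: w) → start (true :: w) → middle w` and fixes all other vertices. -/
def bFun : Vertex α → Vertex α
  | ⟨w, i⟩ =>
    if i = (α (w.length + 1) : ZMod _) then start α (false :: w)
    else if i = 0 then
      match w with
      | [] => start α []
      | false :: v => start α (true :: v)
      | true :: v => middle α v
    else ⟨w, i⟩

/-- The map given by `b⁻¹`. -/
def bInvFun : Vertex α → Vertex α
  | ⟨w, i⟩ =>
    if i = (α (w.length + 1) : ZMod _) then start α (true :: w)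
    else if i = 0 then
      match w with
      | [] => start α []
      | false :: v => middle α v
      | true :: v => start α (false :: v)
    else ⟨w, i⟩

variable {α}

theorem zero_ne_middle (hα : ∀ k, 1 ≤ k → 1 ≤ α k) (k : ℕ) :
    (0 : ZMod (2 * α (k + 1))) ≠ (α (k + 1) : ZMod (2 * α (k + 1))) := by
  intro h
  have h1 := hα (k + 1) (by omega)
  have h2 := (ZMod.natCast_eq_zero_iff (α (k + 1)) (2 * α (k + 1))).1 h.symm
  have h3 := Nat.le_of_dvd h1 h2
  omega

theorem bFun_middle (w : List Bool) : bFun α (middle α w) = start α (false :: w) :=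
  if_pos rfl

theorem bFun_start_false (hα : ∀ k, 1 ≤ k → 1 ≤ α k) (w : List Bool) :
    bFun α (start α (false :: w)) = start α (true :: w) :=
  (if_neg (zero_ne_middle hα _)).trans (if_pos rfl)

theorem bFun_start_true (hα : ∀ k, 1 ≤ k → 1 ≤ α k) (w : List Bool) :
    bFun α (start α (true :: w)) = middle α w :=
  (if_neg (zero_ne_middle hα _)).trans (if_pos rfl)

theorem bFun_root (hα : ∀ k, 1 ≤ k → 1 ≤ α k) : bFun α (root α) = root α :=
  (if_neg (zero_ne_middle hα _)).trans (if_pos rfl)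

theorem bFun_other (w : List Bool) (i : ZMod (2 * α (w.length + 1)))
    (h₁ : i ≠ (α (w.length + 1) : ZMod _)) (h₂ : i ≠ 0) : bFun α ⟨w, i⟩ = ⟨w, i⟩ :=
  (if_neg h₁).trans (if_neg h₂)

theorem bInvFun_middle (w : List Bool) : bInvFun α (middle α w) = start α (true :: w) :=
  if_pos rfl

theorem bInvFun_start_false (hα : ∀ k, 1 ≤ k → 1 ≤ α k) (w : List Bool) :
    bInvFun α (start α (false :: w)) = middle α w :=
  (if_neg (zero_ne_middle hα _)).trans (if_pos rfl)

theorem bInvFun_start_true (hα : ∀ k, 1 ≤ k → 1 ≤ α k) (w : List Bool) :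
    bInvFun α (start α (true :: w)) = start α (false :: w) :=
  (if_neg (zero_ne_middle hα _)).trans (if_pos rfl)

theorem bInvFun_root (hα : ∀ k, 1 ≤ k → 1 ≤ α k) : bInvFun α (root α) = root α :=
  (if_neg (zero_ne_middle hα _)).trans (if_pos rfl)

theorem bInvFun_other (w : List Bool) (i : ZMod (2 * α (w.length + 1)))
    (h₁ : i ≠ (α (w.length + 1) : ZMod _)) (h₂ : i ≠ 0) : bInvFun α ⟨w, i⟩ = ⟨w, i⟩ :=
  (if_neg h₁).trans (if_neg h₂)

/-- Every vertex is the root, a middle point, another starting point, or on no branching cycle. -/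
theorem vertex_cases {P : Vertex α → Prop} (h_root : P (root α))
    (h_middle : ∀ w, P (middle α w)) (h_false : ∀ w, P (start α (false :: w)))
    (h_true : ∀ w, P (start α (true :: w)))
    (h_other : ∀ (w : List Bool) (i : ZMod (2 * α (w.length + 1))),
      i ≠ (α (w.length + 1) : ZMod _) → i ≠ 0 → P ⟨w, i⟩) (x : Vertex α) : P x := by
  obtain ⟨w, i⟩ := x
  by_cases h₁ : i = (α (w.length + 1) : ZMod _)
  · subst h₁
    exact h_middle w
  · by_cases h₂ : i = 0
    · subst h₂
      rcases w with _ | ⟨_ | _, v⟩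
      · exact h_root
      · exact h_false v
      · exact h_true v
    · exact h_other w i h₁ h₂

/-- The generator `b`. -/
def b (hα : ∀ k, 1 ≤ k → 1 ≤ α k) : Equiv.Perm (Vertex α) where
  toFun := bFun α
  invFun := bInvFun α
  left_inv := vertex_cases (by rw [bFun_root hα, bInvFun_root hα])
    (fun w => by rw [bFun_middle, bInvFun_start_false hα])
    (fun w => by rw [bFun_start_false hα, bInvFun_start_true hα])
    (fun w => by rw [bFun_start_true hα, bInvFun_middle])
    (fun w i h₁ h₂ => by rw [bFun_other w i h₁ h₂, bInvFun_other w i h₁ h₂])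
  right_inv := vertex_cases (by rw [bInvFun_root hα, bFun_root hα])
    (fun w => by rw [bInvFun_middle, bFun_start_true hα])
    (fun w => by rw [bInvFun_start_false hα, bFun_middle])
    (fun w => by rw [bInvFun_start_true hα, bFun_start_false hα])
    (fun w i h₁ h₂ => by rw [bInvFun_other w i h₁ h₂, bFun_other w i h₁ h₂])

/-- The bubble group `Γ(α)`: the group of permutations of the vertices generated by `a` and `b`.
It acts on the vertices from the left by evaluation; the corresponding right action is
`x.g = g⁻¹ x`. -/
abbrev BubbleGroup (hα : ∀ k, 1 ≤ k → 1 ≤ α k) : Subgroup (Equiv.Perm (Vertex α)) :=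
  Subgroup.closure {a α, b hα}

/-- `a` as an element of the bubble group. -/
def genA (hα : ∀ k, 1 ≤ k → 1 ≤ α k) : BubbleGroup hα :=
  ⟨a α, Subgroup.subset_closure (by simp)⟩

/-- `b` as an element of the bubble group. -/
def genB (hα : ∀ k, 1 ≤ k → 1 ≤ α k) : BubbleGroup hα :=
  ⟨b hα, Subgroup.subset_closure (by simp)⟩

/-- The step distribution of the simple random walk on the bubble group: each of
`a, a⁻¹, b, b⁻¹` is chosen with probability `1/4`. -/
def simpleStep (hα : ∀ k, 1 ≤ k → 1 ≤ α k) : PMF (BubbleGroup hα) :=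
  (PMF.uniformOfFintype (Fin 4)).map ![genA hα, (genA hα)⁻¹, genB hα, (genB hα)⁻¹]

/-- The scaling sequence `α_k = ⌈2^k / k^2⌉`, `k ≥ 1` (the value at `k = 0` is not used). -/
def scaling (k : ℕ) : ℕ := ⌈(2 : ℚ) ^ k / (k : ℚ) ^ 2⌉₊

theorem one_le_scaling : ∀ k, 1 ≤ k → 1 ≤ scaling k := by
  intro k hk
  have : (0 : ℚ) < k := by exact_mod_cast hk
  exact Nat.one_le_ceil_iff.2 (by positivity)

/-- The Schreier graph `S` (its vertex set) for this scaling sequence. -/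
abbrev S : Type := Vertex scaling

/-- The bubble group `Γ` for this scaling sequence. -/
abbrev Γ : Subgroup (Equiv.Perm S) := BubbleGroup one_le_scaling

/-- The group `G = ℤ₂ ≀_S Γ`. -/
abbrev G : Type := PermWreath (ZMod 2) S Γ

/-- The step distribution on `G` of the switch-walk-switch random walk that is induced by the
simple random walk on `Γ` and the uniform distribution on `ℤ₂`, with switches at the root. -/
def stepLaw : PMF G :=
  PermWreath.switchWalkSwitch (root scaling) (PMF.uniformOfFintype (ZMod 2))
    (simpleStep one_le_scaling)

end Bubble

end

noncomputable section

/-! ### Walks with uniformly indexed increments: expectations and Cauchy–Schwarz -/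

namespace RandomWalk

variable {G : Type*} [Group G] {ι : Type*} [Fintype ι]

/-! Write x.g = g⁻¹ • x. For each vertex x, the process x.X_n is a simple random walk on S, and a
step re-randomises the lamp at x exactly when that walk is at the root just before or just after the
step. Since ∑ α_k / 2^k converges, the unit flow that splits evenly at every cycle and every
branching has a bounded `potential`, zero at the root and harmonic elsewhere (`sum_potential`,
`sum_potential_root`). One identity, `sum_lamp_mul_potential`, about the product of a function Φ of
the lamp at x and the potential at x.g, is used twice. If Φ is odd and x is the root, the product is
bounded, harmonic and nonconstant. If Φ indicates that the lamp is on, the sum over x grows by 1/8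
per step in expectation, while it is at most a constant times the number of lit lamps, hence of the
word length.

For the return probability, symmetry and Cauchy–Schwarz give p_{2n} ≥ P(X_n ∈ A)² / |A|
(`sq_sum_law_le`). The set A consists of the products of words all of whose prefixes have
`a`-exponent in [-m, m] (`Confined`). This exponent is a lazy walk on ℤ, so X_n ∈ A has probability
at least exp(-2n/(m+1)²) (`Confined.le_markov_iterate`). If all cycles from some level on are long
compared with m, a confined word cannot cross them: there it is a translation away from the
branching cycles, and it acts in the same way near all of them. So an element of A is determined by
its lamps and action on the first levels, its exponent, and its action on a single tripod
(`Confined.eq_of`). With k levels this gives log |A| = O(4^k k). The choices m ≈ 2^k / (5k²) and n ≈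
16^k balance the two costs up to powers of k, and |log p_{2n}| = O(√n log⁴ n). -/

/-- The Markov operator of the walk whose increments are `s i` for a uniform index `i`. -/
def markov (s : ι → G) (F : G → ℝ) (g : G) : ℝ :=
  (∑ i, F (g * s i)) / Fintype.card ι

theorem markov_iterate_comp_mul_left (s : ι → G) (F : G → ℝ) (k : G) (n : ℕ) (g : G) :
    (markov s)^[n] (fun x => F (k * x)) g = (markov s)^[n] F (k * g) := by
  induction n generalizing g with
  | zero => rfl
  | succ n ih =>
    rw [Function.iterate_succ_apply', Function.iterate_succ_apply']
    simp only [markov, ih, mul_assoc]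

variable [Nonempty ι]

theorem map_uniform_toReal {G : Type*} (s : ι → G) [DecidableEq G] (h : G) :
    (((PMF.uniformOfFintype ι).map s) h).toReal =
      (∑ i, if h = s i then (1 : ℝ) else 0) / Fintype.card ι := by
  rw [PMF.map_apply, tsum_fintype, ENNReal.toReal_sum, Finset.sum_div]
  · refine Finset.sum_congr rfl fun i _ => ?_
    by_cases hi : h = s i <;> simp [hi]
  · intro i _
    split_ifs <;> simp

theorem hasSum_map_uniform (s : ι → G) (F : G → ℝ) :
    HasSum (fun h => F h * (((PMF.uniformOfFintype ι).map s) h).toReal) (markov s F 1) := by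
  classical
  have h1 : ∀ i ∈ (Finset.univ : Finset ι),
      HasSum (fun h => F h * (if h = s i then (1 : ℝ) else 0) / Fintype.card ι)
        (F (s i) / Fintype.card ι) := by
    intro i _
    have := hasSum_ite_eq (s i) (F (s i) / (Fintype.card ι : ℝ))
    refine this.congr_fun ?_
    intro h
    by_cases hi : h = s i <;> simp [hi]
  have h2 := hasSum_sum h1
  convert h2 using 1
  · funext h
    rw [map_uniform_toReal, Finset.sum_div, Finset.mul_sum]
    exact Finset.sum_congr rfl fun i _ => by ring
  · simp [markov, Finset.sum_div]

theorem law_succ_toReal (s : ι → G) (n : ℕ) (g : G) :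
    (law ((PMF.uniformOfFintype ι).map s) (n + 1) g).toReal =
      (∑ i, (law ((PMF.uniformOfFintype ι).map s) n (g * (s i)⁻¹)).toReal) / Fintype.card ι := by
  classical
  set μ := (PMF.uniformOfFintype ι).map s with hμ
  have h1 : law μ (n + 1) = (PMF.uniformOfFintype ι).bind fun i =>
      (law μ n).map fun g => g * s i := by
    simp only [law, hμ, PMF.map, PMF.bind_bind, PMF.pure_bind, Function.comp_def]
    exact PMF.bind_comm _ _ _
  have h2 : ∀ i, ((law μ n).map fun g => g * s i) g = law μ n (g * (s i)⁻¹) := by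
    intro i
    rw [PMF.map_apply, tsum_eq_single (g * (s i)⁻¹)]
    · simp
    · intro k hk
      rw [if_neg]
      rintro rfl
      simp at hk
  rw [h1, PMF.bind_apply, tsum_fintype, ENNReal.toReal_sum, Finset.sum_div]
  · refine Finset.sum_congr rfl fun i _ => ?_
    rw [h2]
    simp [div_eq_inv_mul]
  · intro i _
    exact ENNReal.mul_ne_top (PMF.apply_ne_top _ _) (PMF.apply_ne_top _ _)

/-- Expectations under the n-step law are iterates of the Markov operator at 1. No bound on F is
needed because the increments take finitely many values; this matters for the word length. -/
theorem hasSum_law (s : ι → G) (n : ℕ) (F : G → ℝ) :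
    HasSum (fun g => (law ((PMF.uniformOfFintype ι).map s) n g).toReal * F g)
      ((markov s)^[n] F 1) := by
  classical
  induction n generalizing F with
  | zero =>
    have := hasSum_ite_eq (1 : G) (F 1)
    refine this.congr_fun ?_
    intro g
    by_cases hg : g = 1 <;> simp [law, hg]
  | succ n ih =>
    set μ := (PMF.uniformOfFintype ι).map s with hμ
    have h1 : ∀ i, HasSum (fun g => (law μ n (g * (s i)⁻¹)).toReal * F g)
        ((markov s)^[n] (fun g => F (g * s i)) 1) := by
      intro i
      have := (Equiv.mulRight (s i)⁻¹).hasSum_iff.2 (ih (fun g => F (g * s i)))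
      simpa [Function.comp_def] using this
    have h2 : HasSum (fun g => (law μ (n + 1) g).toReal * F g)
        ((∑ i, (markov s)^[n] (fun g => F (g * s i)) 1) / Fintype.card ι) := by
      have := (hasSum_sum fun i (_ : i ∈ Finset.univ) => h1 i).div_const (Fintype.card ι : ℝ)
      refine this.congr_fun fun g => ?_
      rw [law_succ_toReal, ← Finset.sum_mul]
      ring
    have h3 : HasSum (fun g => (law μ n g).toReal * markov s F g)
        ((∑ i, (markov s)^[n] (fun g => F (g * s i)) 1) / Fintype.card ι) := by
      have := (hasSum_sum fun i (_ : i ∈ Finset.univ) =>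
        ih (fun g => F (g * s i))).div_const (Fintype.card ι : ℝ)
      refine this.congr_fun fun g => ?_
      rw [markov, ← Finset.mul_sum]
      ring
    rw [Function.iterate_succ_apply, (ih (markov s F)).unique h3]
    exact h2

theorem law_toReal_eq_markov_iterate [DecidableEq G] (s : ι → G) (n : ℕ) (g : G) :
    (law ((PMF.uniformOfFintype ι).map s) n g).toReal =
      (markov s)^[n] (fun x => if x = g then 1 else 0) 1 := by
  have h1 := hasSum_law s n (fun x => if x = g then (1 : ℝ) else 0)
  refine HasSum.unique ?_ h1
  have := hasSum_ite_eq g (law ((PMF.uniformOfFintype ι).map s) n g).toReal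
  refine this.congr_fun ?_
  intro x
  by_cases hg : x = g <;> simp [hg]

/-- Left translations commute with the Markov operator, so the starting point h can be moved to 1.
-/
theorem markov_iterate_indicator [DecidableEq G] (s : ι → G) (n : ℕ) (g h : G) :
    (markov s)^[n] (fun x => if x = g then 1 else 0) h =
      (law ((PMF.uniformOfFintype ι).map s) n (h⁻¹ * g)).toReal := by
  rw [law_toReal_eq_markov_iterate]
  have := markov_iterate_comp_mul_left s (fun x => if x = g then (1 : ℝ) else 0) h n 1
  rw [mul_one] at this
  rw [← this]
  simp only [eq_inv_mul_iff_mul_eq]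

theorem law_symm (s : ι → G) (σ : Equiv.Perm ι) (hσ : ∀ i, s (σ i) = (s i)⁻¹) (n : ℕ) (g : G) :
    (law ((PMF.uniformOfFintype ι).map s) n g⁻¹).toReal =
      (law ((PMF.uniformOfFintype ι).map s) n g).toReal := by
  classical
  induction n generalizing g with
  | zero => simp [law]
  | succ n ih =>
    rw [law_succ_toReal, law_toReal_eq_markov_iterate, Function.iterate_succ_apply', markov,
      ← Equiv.sum_comp σ (fun i => (markov s)^[n] (fun x => if x = g then (1 : ℝ) else 0) _)]
    congr 1
    refine Finset.sum_congr rfl fun i _ => ?_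
    rw [markov_iterate_indicator, hσ, ← ih]
    simp

theorem sq_sum_law_le (s : ι → G) (σ : Equiv.Perm ι) (hσ : ∀ i, s (σ i) = (s i)⁻¹) (n : ℕ)
    (A : Finset G) :
    (∑ g ∈ A, (law ((PMF.uniformOfFintype ι).map s) n g).toReal) ^ 2 ≤
      A.card * returnProb ((PMF.uniformOfFintype ι).map s) (2 * n) := by
  classical
  set μ := (PMF.uniformOfFintype ι).map s with hμ
  -- Chapman–Kolmogorov at the midpoint: by symmetry, returning from g in n steps is as likely as
  -- reaching g.
  have h1 : HasSum (fun g => (law μ n g).toReal ^ 2) (returnProb μ (2 * n)) := by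
    have := hasSum_law s n ((markov s)^[n] (fun x => if x = 1 then 1 else 0))
    rw [← Function.iterate_add_apply, ← two_mul, ← law_toReal_eq_markov_iterate] at this
    refine this.congr_fun fun g => ?_
    rw [markov_iterate_indicator, mul_one, law_symm s σ hσ, sq]
  refine sq_sum_le_card_mul_sum_sq.trans ?_
  gcongr
  exact sum_le_hasSum A (fun g _ => sq_nonneg _) h1

theorem sum_law_eq [DecidableEq G] (s : ι → G) (n : ℕ) (A : Finset G) :
    ∑ g ∈ A, (law ((PMF.uniformOfFintype ι).map s) n g).toReal =
      (markov s)^[n] (fun g => if g ∈ A then 1 else 0) 1 := by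
  refine HasSum.unique ?_ (hasSum_law s n _)
  have := hasSum_sum_of_ne_finset_zero (L := .unconditional G) (s := A)
    (f := fun g => (law ((PMF.uniformOfFintype ι).map s) n g).toReal * if g ∈ A then (1 : ℝ) else 0)
    (fun g hg => by simp [hg])
  convert this using 1
  exact Finset.sum_congr rfl fun g hg => by simp [hg]

end RandomWalk

/-! ### The switch-walk-switch increments and their symmetry -/

namespace Bubble

variable {α : ℕ → ℕ} (hα : ∀ k, 1 ≤ k → 1 ≤ α k)

/-- The four generators `a, a⁻¹, b, b⁻¹` of the bubble group. -/
def gen : Fin 4 → BubbleGroup hα :=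
  ![genA hα, (genA hα)⁻¹, genB hα, (genB hα)⁻¹]

/-- The increments of the switch-walk-switch walk, indexed by the two switches and the letter. -/
def step (ω : ZMod 2 × Fin 4 × ZMod 2) : PermWreath (ZMod 2) (Vertex α) (BubbleGroup hα) :=
  PermWreath.switch (root α) ω.1 * SemidirectProduct.inr (gen hα ω.2.1) *
    PermWreath.switch (root α) ω.2.2

/-- Indexing the step by 16 equally likely triples turns every one-step expectation into a finite
sum. -/
theorem switchWalkSwitch_eq_map :
    PermWreath.switchWalkSwitch (root α) (PMF.uniformOfFintype (ZMod 2)) (simpleStep hα) =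
      (PMF.uniformOfFintype (ZMod 2 × Fin 4 × ZMod 2)).map (step hα) := by
  classical
  ext h
  simp only [PermWreath.switchWalkSwitch, simpleStep, PMF.bind_map, PMF.bind_apply, PMF.map_apply,
    tsum_fintype, Fintype.sum_prod_type, PMF.uniformOfFintype_apply, PMF.pure_apply,
    Function.comp_apply, Finset.mul_sum]
  refine Finset.sum_congr rfl fun l _ => Finset.sum_congr rfl fun s _ =>
    Finset.sum_congr rfl fun l' _ => ?_
  have h16 : ((Fintype.card (ZMod 2) : ENNReal))⁻¹ * ((Fintype.card (Fin 4) : ENNReal)⁻¹ *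
      (Fintype.card (ZMod 2) : ENNReal)⁻¹) =
      (Fintype.card (ZMod 2 × Fin 4 × ZMod 2) : ENNReal)⁻¹ := by
    simp only [Fintype.card_prod, Nat.cast_mul]
    rw [ENNReal.mul_inv (by simp) (by simp), ENNReal.mul_inv (by simp) (by simp)]
  have hstep : step hα (l, s, l') = PermWreath.switch (root α) l *
    SemidirectProduct.inr (![genA hα, (genA hα)⁻¹, genB hα, (genB hα)⁻¹] s) *
    PermWreath.switch (root α) l' := rfl
  rw [hstep, ← h16]
  split_ifs <;> simp

theorem switch_inv (l : ZMod 2) :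
    (PermWreath.switch (root α) l : PermWreath (ZMod 2) (Vertex α) (BubbleGroup hα))⁻¹ =
      PermWreath.switch (root α) l := by
  rw [PermWreath.switch, ← map_inv, ← ofAdd_neg, ← Finsupp.single_neg, ZModModule.neg_eq_self]

theorem gen_swap (s : Fin 4) : gen hα (![1, 0, 3, 2] s) = (gen hα s)⁻¹ := by
  fin_cases s <;> simp [gen]

/-- The involution of the index set of `step` that corresponds to inversion. -/
def stepSymm : Equiv.Perm (ZMod 2 × Fin 4 × ZMod 2) where
  toFun ω := (ω.2.2, ![1, 0, 3, 2] ω.2.1, ω.1)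
  invFun ω := (ω.2.2, ![1, 0, 3, 2] ω.2.1, ω.1)
  left_inv := by
    rintro ⟨l, s, l'⟩
    fin_cases s <;> rfl
  right_inv := by
    rintro ⟨l, s, l'⟩
    fin_cases s <;> rfl

theorem step_stepSymm (ω : ZMod 2 × Fin 4 × ZMod 2) : step hα (stepSymm ω) = (step hα ω)⁻¹ := by
  simp only [step, stepSymm, Equiv.coe_fn_mk, gen_swap, mul_inv_rev, switch_inv, map_inv, mul_assoc]

theorem map_step_symm (g : PermWreath (ZMod 2) (Vertex α) (BubbleGroup hα)) :
    (PMF.uniformOfFintype (ZMod 2 × Fin 4 × ZMod 2)).map (step hα) g⁻¹ =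
      (PMF.uniformOfFintype (ZMod 2 × Fin 4 × ZMod 2)).map (step hα) g := by
  classical
  rw [PMF.map_apply, PMF.map_apply, tsum_fintype, tsum_fintype, ← Equiv.sum_comp stepSymm]
  simp only [step_stepSymm, inv_inj, PMF.uniformOfFintype_apply]

theorem support_map_step :
    ((PMF.uniformOfFintype (ZMod 2 × Fin 4 × ZMod 2)).map (step hα)).support =
      Set.range (step hα) := by
  simp [PMF.support_map]

/-! ### Generation -/

theorem genA_smul (w : List Bool) (i : ZMod (2 * α (w.length + 1))) :
    genA hα • (⟨w, i⟩ : Vertex α) = ⟨w, i + 1⟩ := rfl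

theorem genA_inv_smul (w : List Bool) (i : ZMod (2 * α (w.length + 1))) :
    (genA hα)⁻¹ • (⟨w, i⟩ : Vertex α) = ⟨w, i - 1⟩ := by
  rw [inv_smul_eq_iff, genA_smul, sub_add_cancel]

theorem genB_smul (x : Vertex α) : genB hα • x = bFun α x := rfl

theorem genB_inv_smul (x : Vertex α) : (genB hα)⁻¹ • x = bInvFun α x := rfl

theorem genA_pow_smul (w : List Bool) (n : ℕ) :
    genA hα ^ n • start α w = ⟨w, (n : ZMod _)⟩ := by
  induction n with
  | zero => simp [start]
  | succ n ih => rw [pow_succ', mul_smul, ih, genA_smul, Nat.cast_succ]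

theorem exists_smul_root (x : Vertex α) : ∃ g : BubbleGroup hα, g • root α = x := by
  have h1 : ∀ w : List Bool, ∃ g : BubbleGroup hα, g • root α = start α w := by
    intro w
    induction w with
    | nil => exact ⟨1, one_smul _ _⟩
    | cons c w ih =>
      obtain ⟨g, hg⟩ := ih
      have hm : (genA hα ^ α (w.length + 1) * g) • root α = middle α w := by
        rw [mul_smul, hg, genA_pow_smul, middle]
      have hf : (genB hα * (genA hα ^ α (w.length + 1) * g)) • root α =
          start α (false :: w) := by
        rw [mul_smul, hm, genB_smul, bFun_middle]
      cases c with
      | false => exact ⟨_, hf⟩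
      | true =>
        refine ⟨genB hα * (genB hα * (genA hα ^ α (w.length + 1) * g)), ?_⟩
        rw [mul_smul, hf, genB_smul, bFun_start_false hα]
  obtain ⟨w, i⟩ := x
  obtain ⟨g, hg⟩ := h1 w
  have : NeZero (2 * α (w.length + 1)) := ⟨by have := hα (w.length + 1) (by omega); omega⟩
  refine ⟨genA hα ^ i.val * g, ?_⟩
  rw [mul_smul, hg, genA_pow_smul, ZMod.natCast_zmod_val]

theorem inr_conj_switch (g : BubbleGroup hα) (l : ZMod 2) :
    (SemidirectProduct.inr g * PermWreath.switch (root α) l * (SemidirectProduct.inr g)⁻¹ :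
      PermWreath (ZMod 2) (Vertex α) (BubbleGroup hα)) = PermWreath.switch (g • root α) l := by
  rw [PermWreath.switch, PermWreath.switch, ← map_inv, ← SemidirectProduct.inl_aut]
  congr 1
  exact congrArg Multiplicative.ofAdd (Finsupp.equivMapDomain_single _ _ _)

/-- Trivial switches yield the generators of the bubble group, and cancelling a letter yields the
switch at the root. By transitivity, conjugation carries this switch to every vertex, and such
switches generate all configurations. -/
theorem closure_range_step : Subgroup.closure (Set.range (step hα)) = ⊤ := by
  set H := Subgroup.closure (Set.range (step hα)) with hH
  have hstep : ∀ ω, step hα ω ∈ H := fun ω => Subgroup.subset_closure ⟨ω, rfl⟩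
  have hswitch0 : (PermWreath.switch (root α) 0 :
      PermWreath (ZMod 2) (Vertex α) (BubbleGroup hα)) = 1 := by
    rw [PermWreath.switch, Finsupp.single_zero, ofAdd_zero, map_one]
  have hgen : ∀ s, (SemidirectProduct.inr (gen hα s) :
      PermWreath (ZMod 2) (Vertex α) (BubbleGroup hα)) ∈ H := by
    intro s
    simpa [step, hswitch0] using hstep (0, s, 0)
  have hsw : ∀ l, (PermWreath.switch (root α) l :
      PermWreath (ZMod 2) (Vertex α) (BubbleGroup hα)) ∈ H := by
    intro l
    have := mul_mem (hstep (l, 0, 0)) (inv_mem (hgen 0))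
    simpa [step, hswitch0] using this
  have hinr : ∀ g : BubbleGroup hα, (SemidirectProduct.inr g :
      PermWreath (ZMod 2) (Vertex α) (BubbleGroup hα)) ∈ H := by
    rintro ⟨g, hg⟩
    induction hg using Subgroup.closure_induction with
    | mem x hx =>
      rcases hx with rfl | rfl
      · exact hgen 0
      · exact hgen 2
    | one => exact one_mem H
    | mul x y hx hy h1 h2 =>
      have := mul_mem h1 h2
      rwa [← map_mul] at this
    | inv x hx h1 =>
      have := inv_mem h1
      rwa [← map_inv] at this
  have hswx : ∀ x l, (PermWreath.switch x l :
      PermWreath (ZMod 2) (Vertex α) (BubbleGroup hα)) ∈ H := by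
    intro x l
    obtain ⟨g, rfl⟩ := exists_smul_root hα x
    rw [← inr_conj_switch]
    exact mul_mem (mul_mem (hinr g) (hsw l)) (inv_mem (hinr g))
  have hinl : ∀ f : Vertex α →₀ ZMod 2, (SemidirectProduct.inl (Multiplicative.ofAdd f) :
      PermWreath (ZMod 2) (Vertex α) (BubbleGroup hα)) ∈ H := by
    intro f
    induction f using Finsupp.induction_linear with
    | zero => rw [ofAdd_zero, map_one]; exact one_mem H
    | add f g hf hg => rw [ofAdd_add, map_mul]; exact mul_mem hf hg
    | single x l => exact hswx x l
  rw [eq_top_iff]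
  intro u _
  rw [← SemidirectProduct.inl_left_mul_inr_right u]
  exact mul_mem (hinl (Multiplicative.toAdd u.left)) (hinr _)

/-! ### The lamp configuration -/

theorem step_right (ω : ZMod 2 × Fin 4 × ZMod 2) : (step hα ω).right = gen hα ω.2.1 := by
  simp [step, PermWreath.switch]

theorem mul_step_left_apply (u : PermWreath (ZMod 2) (Vertex α) (BubbleGroup hα))
    (ω : ZMod 2 × Fin 4 × ZMod 2) (x : Vertex α) :
    Multiplicative.toAdd (u * step hα ω).left x =
      Multiplicative.toAdd u.left x + Finsupp.single (root α) ω.1 (u.right⁻¹ • x) +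
        Finsupp.single (root α) ω.2.2 ((u.right * gen hα ω.2.1)⁻¹ • x) := by
  simp only [step, ← mul_assoc]
  rw [PermWreath.mul_left_apply, PermWreath.mul_left_apply, PermWreath.mul_left_apply]
  simp [PermWreath.switch]

end Bubble

namespace Bubble

/-! ### A bounded function on the bubble graph that is harmonic off the root -/

/-- The distance from `0` on the cycle `ℤ / 2A`. -/
def cycleDist (A : ℕ) (i : ZMod (2 * A)) : ℕ := min i.val (2 * A - i.val)

theorem cycleDist_natCast {A n : ℕ} (hn : n ≤ 2 * A) :
    cycleDist A (n : ZMod (2 * A)) = min n (2 * A - n) := by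
  unfold cycleDist
  rw [ZMod.val_natCast]
  rcases hn.lt_or_eq with h | h
  · rw [Nat.mod_eq_of_lt h]
  · subst h
    simp

theorem cycleDist_zero (A : ℕ) : cycleDist A 0 = 0 := by
  simpa using cycleDist_natCast (A := A) (n := 0) (by omega)

theorem cycleDist_middle (A : ℕ) : cycleDist A (A : ZMod (2 * A)) = A := by
  rw [cycleDist_natCast (by omega)]
  omega

theorem cycleDist_one {A : ℕ} (hA : 1 ≤ A) : cycleDist A (0 + 1) = 1 := by
  have := cycleDist_natCast (A := A) (n := 1) (by omega)
  rw [Nat.cast_one] at this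
  rw [zero_add, this]
  omega

theorem cycleDist_neg_one {A : ℕ} (hA : 1 ≤ A) : cycleDist A (0 - 1) = 1 := by
  have h : (0 - 1 : ZMod (2 * A)) = ((2 * A - 1 : ℕ) : ZMod (2 * A)) := by
    rw [Nat.cast_sub (by omega), ZMod.natCast_self, Nat.cast_one]
  rw [h, cycleDist_natCast (by omega)]
  omega

theorem cycleDist_middle_add_one {A : ℕ} (hA : 1 ≤ A) :
    cycleDist A ((A : ZMod (2 * A)) + 1) = A - 1 := by
  have := cycleDist_natCast (A := A) (n := A + 1) (by omega)
  rw [Nat.cast_succ] at this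
  rw [this]
  omega

theorem cycleDist_middle_sub_one {A : ℕ} (hA : 1 ≤ A) :
    cycleDist A ((A : ZMod (2 * A)) - 1) = A - 1 := by
  have := cycleDist_natCast (A := A) (n := A - 1) (by omega)
  rw [Nat.cast_sub hA, Nat.cast_one] at this
  rw [this]
  omega

/-- The distance is linear along each of the two half-cycles. -/
theorem cycleDist_add_sub {A : ℕ} (hA : 1 ≤ A) (i : ZMod (2 * A)) (h0 : i ≠ 0)
    (h1 : i ≠ (A : ZMod (2 * A))) :
    cycleDist A (i + 1) + cycleDist A (i - 1) = 2 * cycleDist A i := by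
  have : NeZero (2 * A) := ⟨by omega⟩
  obtain ⟨n, hn, rfl⟩ : ∃ n : ℕ, n < 2 * A ∧ (n : ZMod (2 * A)) = i :=
    ⟨i.val, i.val_lt, ZMod.natCast_zmod_val i⟩
  have hn0 : n ≠ 0 := by
    rintro rfl
    exact h0 Nat.cast_zero
  have hnA : n ≠ A := by
    rintro rfl
    exact h1 rfl
  have e1 := cycleDist_natCast (A := A) (n := n + 1) (by omega)
  have e2 := cycleDist_natCast (A := A) (n := n - 1) (by omega)
  rw [Nat.cast_succ] at e1
  rw [Nat.cast_sub (by omega), Nat.cast_one] at e2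
  rw [e1, e2, cycleDist_natCast hn.le]
  omega

/-- The potential of the unit flow from the root to infinity, normalised to vanish at the root. -/
def potential (α : ℕ → ℕ) (x : Vertex α) : ℝ :=
  ∑ j ∈ Finset.range x.1.length, ((α (j + 1) : ℝ) + 1) / 2 ^ (j + 1) +
    (cycleDist (α (x.1.length + 1)) x.2 : ℝ) / 2 ^ (x.1.length + 1)

variable {α : ℕ → ℕ}

theorem potential_nonneg (x : Vertex α) : 0 ≤ potential α x := by
  unfold potential
  positivity

theorem potential_start (w : List Bool) :
    potential α (start α w) =
      ∑ j ∈ Finset.range w.length, ((α (j + 1) : ℝ) + 1) / 2 ^ (j + 1) := by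
  simp [potential, start, cycleDist_zero]

/-- The flow leaving the middle of `w` splits evenly over two `b`-edges, and the two children have
equal potential, so no flow runs between them. -/
theorem potential_start_cons (c : Bool) (w : List Bool) :
    potential α (start α (c :: w)) =
      potential α (middle α w) + 1 / 2 ^ (w.length + 1) := by
  rw [potential_start, List.length_cons, Finset.sum_range_succ, potential, middle,
    cycleDist_middle]
  ring

theorem potential_root : potential α (root α) = 0 :=
  (potential_start []).trans (by simp)

theorem potential_le {U : ℝ}
    (hU : ∀ n, ∑ j ∈ Finset.range n, ((α (j + 1) : ℝ) + 1) / 2 ^ (j + 1) ≤ U) (x : Vertex α) :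
    potential α x ≤ U := by
  refine le_trans ?_ (hU (x.1.length + 1))
  rw [Finset.sum_range_succ, potential]
  gcongr
  have h : cycleDist (α (x.1.length + 1)) x.2 ≤ α (x.1.length + 1) := by
    unfold cycleDist
    omega
  calc (cycleDist (α (x.1.length + 1)) x.2 : ℝ) ≤ α (x.1.length + 1) := by exact_mod_cast h
    _ ≤ _ := by linarith

variable (hα : ∀ k, 1 ≤ k → 1 ≤ α k)

theorem potential_a_start (w : List Bool) :
    potential α (genA hα • start α w) + potential α ((genA hα)⁻¹ • start α w) =
      2 * potential α (start α w) + 2 / 2 ^ (w.length + 1) := by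
  have hA := hα (w.length + 1) (by omega)
  rw [start, genA_smul, genA_inv_smul]
  simp only [potential, cycleDist_zero, cycleDist_one hA,
    cycleDist_neg_one hA]
  push_cast
  ring

theorem potential_a_middle (w : List Bool) :
    potential α (genA hα • middle α w) + potential α ((genA hα)⁻¹ • middle α w) =
      2 * potential α (middle α w) - 2 / 2 ^ (w.length + 1) := by
  have hA := hα (w.length + 1) (by omega)
  rw [middle, genA_smul, genA_inv_smul]
  simp only [potential, cycleDist_middle,
    cycleDist_middle_add_one hA, cycleDist_middle_sub_one hA]
  push_cast [Nat.cast_sub hA]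
  ring

theorem sum_gen_smul (F : Vertex α → ℝ) (x : Vertex α) :
    ∑ s, F ((gen hα s)⁻¹ • x) =
      F (genA hα • x) + F ((genA hα)⁻¹ • x) + (F (genB hα • x) + F ((genB hα)⁻¹ • x)) := by
  simp only [Fin.sum_univ_four, gen, Matrix.cons_val_zero, Matrix.cons_val_one, Matrix.cons_val,
    inv_inv]
  ring

/-- The two `a`-edges at the root carry flow 1/2 each, and `b` fixes the root: this is the unit
source. -/
theorem sum_potential_root : ∑ s, potential α ((gen hα s)⁻¹ • root α) = 1 := by
  have h : root α = start α [] := rfl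
  rw [sum_gen_smul, genB_smul, genB_inv_smul, bFun_root hα, bInvFun_root hα, potential_root, h,
    potential_a_start, ← h, potential_root]
  norm_num

/-- Kirchhoff's law: away from the root, inflow equals outflow. -/
theorem sum_potential (x : Vertex α) (hx : x ≠ root α) :
    ∑ s, potential α ((gen hα s)⁻¹ • x) = 4 * potential α x := by
  rw [sum_gen_smul, genB_smul, genB_inv_smul]
  induction x using vertex_cases with
  | h_root => exact absurd rfl hx
  | h_middle w =>
    rw [potential_a_middle, bFun_middle, bInvFun_middle, potential_start_cons,
      potential_start_cons]
    ring
  | h_false w =>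
    rw [potential_a_start, bFun_start_false hα, bInvFun_start_false hα, potential_start_cons,
      potential_start_cons, List.length_cons]
    field_simp
    ring
  | h_true w =>
    rw [potential_a_start, bFun_start_true hα, bInvFun_start_true hα, potential_start_cons,
      potential_start_cons, List.length_cons]
    field_simp
    ring
  | h_other w i h1 h0 =>
    rw [bFun_other w i h1 h0, bInvFun_other w i h1 h0]
    have h := cycleDist_add_sub (hα (w.length + 1) (by omega)) i h0 h1
    have h' : (cycleDist (α (w.length + 1)) (i + 1) : ℝ) + cycleDist (α (w.length + 1)) (i - 1) =
        2 * cycleDist (α (w.length + 1)) i := by exact_mod_cast h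
    rw [genA_smul, genA_inv_smul]
    simp only [potential]
    linear_combination h' / 2 ^ (w.length + 1)

end Bubble

namespace Bubble

variable {α : ℕ → ℕ} (hα : ∀ k, 1 ≤ k → 1 ≤ α k)

/-! ### Bounded harmonic functions and speed -/

/-- The second switch acts on the lamp at x only if x has just been carried to the root, where the
potential vanishes; so it can be ignored. -/
theorem lamp_mul_potential (Φ : ZMod 2 → ℝ)
    (g : PermWreath (ZMod 2) (Vertex α) (BubbleGroup hα)) (x : Vertex α)
    (ω : ZMod 2 × Fin 4 × ZMod 2) :
    Φ (Multiplicative.toAdd (g * step hα ω).left x) *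
        potential α ((g * step hα ω).right⁻¹ • x) =
      Φ (Multiplicative.toAdd g.left x + Finsupp.single (root α) ω.1 (g.right⁻¹ • x)) *
        potential α ((gen hα ω.2.1)⁻¹ • (g.right⁻¹ • x)) := by
  rw [mul_step_left_apply, SemidirectProduct.mul_right, step_right, mul_inv_rev, mul_smul]
  by_cases h : (gen hα ω.2.1)⁻¹ • (g.right⁻¹ • x) = root α
  · rw [h, potential_root, mul_zero, mul_zero]
  · rw [Finsupp.single_eq_of_ne h, add_zero]

/-- If x.g is not the root, the lamp is unchanged as far as the product sees and the potential is
harmonic. If it is the root, the old product is zero, the first switch makes the lamp uniform, and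
the potentials of the neighbours sum to 1; the factor 2 counts the ignored second switch. -/
theorem sum_lamp_mul_potential (Φ : ZMod 2 → ℝ)
    (g : PermWreath (ZMod 2) (Vertex α) (BubbleGroup hα)) (x : Vertex α) :
    ∑ ω, Φ (Multiplicative.toAdd (g * step hα ω).left x) *
        potential α ((g * step hα ω).right⁻¹ • x) =
      16 * (Φ (Multiplicative.toAdd g.left x) * potential α (g.right⁻¹ • x)) +
        if g.right⁻¹ • x = root α then 2 * (Φ 0 + Φ 1) else 0 := by
  simp only [lamp_mul_potential, Fintype.sum_prod_type, Finset.sum_const, ← Finset.mul_sum,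
    ← Finset.smul_sum]
  by_cases h : g.right⁻¹ • x = root α
  · have h2 : ∀ c : ZMod 2, ∑ l, Φ (c + l) = Φ 0 + Φ 1 := fun c => by
      rw [Fintype.sum_equiv (Equiv.addLeft c) (fun l => Φ (c + l)) Φ fun l => rfl]
      exact Fin.sum_univ_two Φ
    simp only [h, sum_potential_root, Finsupp.single_eq_same, potential_root, if_true]
    rw [← h2 (Multiplicative.toAdd g.left x), Finset.mul_sum]
    simp [mul_comm]
  · simp only [Finsupp.single_eq_of_ne h, sum_potential hα _ h, add_zero, if_neg h]
    simp [ZMod.card]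
    ring

/-- The potential at the root, with a sign that depends on the lamp at the root. -/
def signedPotential (g : PermWreath (ZMod 2) (Vertex α) (BubbleGroup hα)) : ℝ :=
  (if Multiplicative.toAdd g.left (root α) = 0 then 1 else -1) *
    potential α (g.right⁻¹ • root α)

theorem markov_signedPotential (g : PermWreath (ZMod 2) (Vertex α) (BubbleGroup hα)) :
    RandomWalk.markov (step hα) (signedPotential hα) g = signedPotential hα g := by
  have h := sum_lamp_mul_potential hα (fun l => if l = 0 then 1 else -1) g (root α)
  simp only [RandomWalk.markov, signedPotential]
  simp only [if_true, if_neg (one_ne_zero (α := ZMod 2)), add_neg_cancel, mul_zero, ite_self,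
    add_zero] at h
  have hcard : (Fintype.card (ZMod 2 × Fin 4 × ZMod 2) : ℝ) = 16 := by simp
  rw [h, hcard, mul_div_cancel_left₀ _ (by norm_num)]

theorem not_liouville {U : ℝ}
    (hU : ∀ n, ∑ j ∈ Finset.range n, ((α (j + 1) : ℝ) + 1) / 2 ^ (j + 1) ≤ U) :
    ¬ RandomWalk.Liouville
      ((PMF.uniformOfFintype (ZMod 2 × Fin 4 × ZMod 2)).map (step hα)) := by
  intro hL
  obtain ⟨c, hc⟩ := hL (signedPotential hα) ⟨U, fun g => by
    have h1 := potential_nonneg (g.right⁻¹ • root α)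
    have h2 := potential_le hU (g.right⁻¹ • root α)
    unfold signedPotential
    split_ifs <;> simpa [abs_of_nonneg h1] using h2⟩ fun g => by
    have := (RandomWalk.hasSum_map_uniform (step hα) fun h => signedPotential hα (g * h)).tsum_eq
    rw [this, ← markov_signedPotential]
    simp [RandomWalk.markov]
  obtain ⟨s, hs⟩ : ∃ s, potential α ((gen hα s)⁻¹ • root α) ≠ 0 := by
    by_contra! h
    have := sum_potential_root hα
    simp [h] at this
  -- Two elements that differ only in the lamp at the root have opposite, nonzero values.
  have e0 := hc (SemidirectProduct.inr (gen hα s))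
  have e1 := hc (PermWreath.switch (root α) 1 * SemidirectProduct.inr (gen hα s))
  rw [← e0] at e1
  simp only [signedPotential, PermWreath.mul_left_apply, PermWreath.switch] at e1
  simp at e1
  exact hs (by linarith)

/-- The total potential of the lamps that are on, as seen from the current position. -/
def lampPotential (g : PermWreath (ZMod 2) (Vertex α) (BubbleGroup hα)) : ℝ :=
  ∑ x ∈ (Multiplicative.toAdd g.left).support, potential α (g.right⁻¹ • x)

theorem lampPotential_eq (g : PermWreath (ZMod 2) (Vertex α) (BubbleGroup hα))
    {E : Finset (Vertex α)} (hE : (Multiplicative.toAdd g.left).support ⊆ E) :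
    lampPotential hα g = ∑ x ∈ E, (if Multiplicative.toAdd g.left x = 0 then 0 else 1) *
      potential α (g.right⁻¹ • x) := by
  rw [lampPotential]
  refine (Finset.sum_congr rfl fun x hx => ?_).trans (Finset.sum_subset hE fun x _ hx => ?_)
  · rw [if_neg (Finsupp.mem_support_iff.1 hx), one_mul]
  · rw [if_pos (Finsupp.notMem_support_iff.1 hx), zero_mul]

/-- With Φ the indicator of a lit lamp, only the one vertex currently carried to the root
contributes a gain, namely 2/16. -/
theorem markov_lampPotential (g : PermWreath (ZMod 2) (Vertex α) (BubbleGroup hα)) :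
    RandomWalk.markov (step hα) (lampPotential hα) g = lampPotential hα g + 1 / 8 := by
  classical
  -- A finite set containing all lamps that can be on before or after one step, so that the sums
  -- over lamps and over increments can be exchanged.
  set E : Finset (Vertex α) := insert (g.right • root α) ((Multiplicative.toAdd g.left).support ∪
    Finset.univ.image fun s => (g.right * gen hα s) • root α) with hE
  have h1 : (Multiplicative.toAdd g.left).support ⊆ E := fun x hx => by
    simp only [hE, Finset.mem_insert, Finset.mem_union]
    exact Or.inr (Or.inl hx)
  have h2 : ∀ ω, (Multiplicative.toAdd (g * step hα ω).left).support ⊆ E := fun ω x hx => by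
    by_contra hxE
    simp only [hE, Finset.mem_insert, Finset.mem_union, Finset.mem_image, Finset.mem_univ,
      true_and, not_or, not_exists, Finsupp.notMem_support_iff] at hxE
    refine Finsupp.mem_support_iff.1 hx ?_
    rw [mul_step_left_apply, hxE.2.1, Finsupp.single_eq_of_ne, Finsupp.single_eq_of_ne]
    · simp
    · rw [ne_eq, inv_smul_eq_iff]
      exact fun h => hxE.2.2 _ h.symm
    · rw [ne_eq, inv_smul_eq_iff]
      exact hxE.1
  rw [RandomWalk.markov, Finset.sum_congr rfl fun ω _ => lampPotential_eq hα _ (h2 ω),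
    Finset.sum_comm, Finset.sum_congr rfl fun x _ =>
      sum_lamp_mul_potential hα (fun l => if l = 0 then 0 else 1) g x,
    Finset.sum_add_distrib, ← Finset.mul_sum, ← lampPotential_eq hα g h1]
  have h3 : ∀ x, g.right⁻¹ • x = root α ↔ x = g.right • root α := fun x => inv_smul_eq_iff
  simp only [h3, Finset.sum_ite_eq']
  rw [if_pos (Finset.mem_insert_self _ _)]
  simp [ZMod.card]
  ring

theorem markov_iterate_lampPotential (n : ℕ)
    (g : PermWreath (ZMod 2) (Vertex α) (BubbleGroup hα)) :
    (RandomWalk.markov (step hα))^[n] (lampPotential hα) g = lampPotential hα g + n / 8 := by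
  induction n generalizing g with
  | zero => simp
  | succ n ih =>
    rw [Function.iterate_succ_apply', funext ih]
    have h := markov_lampPotential hα g
    simp only [RandomWalk.markov, Finset.sum_add_distrib, add_div] at h ⊢
    rw [h]
    simp
    ring

theorem card_support_mul_le (u v : PermWreath (ZMod 2) (Vertex α) (BubbleGroup hα)) :
    (Multiplicative.toAdd (u * v).left).support.card ≤
      (Multiplicative.toAdd u.left).support.card +
        (Multiplicative.toAdd v.left).support.card := by
  classical
  rw [← Finset.card_image_of_injective (Multiplicative.toAdd v.left).support
    (MulAction.injective u.right)]
  refine le_trans (Finset.card_le_card fun x hx => ?_) (Finset.card_union_le _ _)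
  rw [Finset.mem_union]
  by_contra! h
  rw [Finsupp.mem_support_iff, PermWreath.mul_left_apply, Finsupp.notMem_support_iff.1 h.1,
    zero_add, ← Finsupp.mem_support_iff] at hx
  exact h.2 (Finset.mem_image.2 ⟨_, hx, smul_inv_smul _ _⟩)

theorem card_support_inv_le (u : PermWreath (ZMod 2) (Vertex α) (BubbleGroup hα)) :
    (Multiplicative.toAdd u⁻¹.left).support.card ≤ (Multiplicative.toAdd u.left).support.card := by
  classical
  rw [← Finset.card_image_of_injective (Multiplicative.toAdd u.left).support
    (MulAction.injective u.right⁻¹)]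
  refine Finset.card_le_card fun x hx => Finset.mem_image.2 ⟨u.right • x, ?_, inv_smul_smul _ _⟩
  have h := PermWreath.mul_left_apply u u⁻¹ (u.right • x)
  rw [mul_inv_cancel, inv_smul_smul] at h
  rw [Finsupp.mem_support_iff] at hx ⊢
  intro h0
  rw [h0, zero_add] at h
  exact hx h.symm

/-- The number of lit lamps is subadditive and does not increase under inversion, so C can be its
maximum over the generators. -/
theorem exists_card_support_le_wordLength
    {T : Set (PermWreath (ZMod 2) (Vertex α) (BubbleGroup hα))} (hT : T.Finite)
    (hcl : Subgroup.closure T = ⊤) :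
    ∃ C : ℕ, ∀ g, (Multiplicative.toAdd g.left).support.card ≤
      C * RandomWalk.wordLength T g := by
  obtain ⟨C, hC⟩ : ∃ C : ℕ, ∀ t ∈ T, (Multiplicative.toAdd t.left).support.card ≤ C := by
    obtain ⟨C, hC⟩ := (hT.image fun t => (Multiplicative.toAdd t.left).support.card).bddAbove
    exact ⟨C, fun t ht => hC ⟨t, ht, rfl⟩⟩
  refine ⟨C, fun g => ?_⟩
  have hne : {n | ∃ l : List (PermWreath (ZMod 2) (Vertex α) (BubbleGroup hα)),
      l.length = n ∧ (∀ x ∈ l, x ∈ T ∨ x⁻¹ ∈ T) ∧ l.prod = g}.Nonempty := by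
    have hmem : g ∈ (Subgroup.closure T).toSubmonoid := hcl ▸ Subgroup.mem_top g
    rw [Subgroup.closure_toSubmonoid] at hmem
    obtain ⟨l, hl, hg⟩ := Submonoid.exists_list_of_mem_closure hmem
    exact ⟨l.length, l, rfl, hl, hg⟩
  obtain ⟨l, hlen, hl, hg⟩ := Nat.sInf_mem hne
  rw [RandomWalk.wordLength, ← hlen, ← hg]
  clear hlen hg hne
  induction l with
  | nil => simp
  | cons t l ih =>
    rw [List.prod_cons, List.length_cons]
    have h1 := ih fun x hx => hl x (List.mem_cons_of_mem _ hx)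
    have h2 : (Multiplicative.toAdd t.left).support.card ≤ C := by
      rcases hl t List.mem_cons_self with h | h
      · exact hC t h
      · have := card_support_inv_le hα t⁻¹
        rw [inv_inv] at this
        exact this.trans (hC _ h)
    calc _ ≤ _ := card_support_mul_le hα _ _
      _ ≤ C + C * l.length := add_le_add h2 h1
      _ = _ := by ring

theorem positiveSpeed {U : ℝ}
    (hU : ∀ n, ∑ j ∈ Finset.range n, ((α (j + 1) : ℝ) + 1) / 2 ^ (j + 1) ≤ U) :
    RandomWalk.PositiveSpeed
      ((PMF.uniformOfFintype (ZMod 2 × Fin 4 × ZMod 2)).map (step hα)) := by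
  intro T hT hcl
  obtain ⟨C, hC⟩ := exists_card_support_le_wordLength hα hT hcl
  have hU0 : 0 ≤ U := by simpa using hU 0
  have hpos : 0 < U * C + 1 := by positivity
  -- The potential of lit lamps has mean n/8 and is at most U * C times the word length; the extra 1
  -- only avoids a zero denominator.
  refine ⟨1 / (8 * (U * C + 1)), by positivity, fun n => ?_⟩
  have h1 := RandomWalk.hasSum_law (step hα) n (lampPotential hα)
  have h2 := (RandomWalk.hasSum_law (step hα) n
    fun g => (RandomWalk.wordLength T g : ℝ)).mul_left (U * C + 1)
  have h3 : ∀ g, lampPotential hα g ≤ (U * C + 1) * RandomWalk.wordLength T g := by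
    intro g
    calc lampPotential hα g
        ≤ ∑ x ∈ (Multiplicative.toAdd g.left).support, U :=
          Finset.sum_le_sum fun x _ => potential_le hU _
      _ = U * (Multiplicative.toAdd g.left).support.card := by simp [mul_comm]
      _ ≤ U * (C * RandomWalk.wordLength T g) := by
          gcongr
          exact_mod_cast hC g
      _ ≤ _ := by
          have : (0 : ℝ) ≤ RandomWalk.wordLength T g := Nat.cast_nonneg _
          linarith
  have h4 := hasSum_le (fun g => by
    rw [mul_left_comm]
    exact mul_le_mul_of_nonneg_left (h3 g) ENNReal.toReal_nonneg) h1 h2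
  rw [(RandomWalk.hasSum_law (step hα) n _).tsum_eq]
  rw [markov_iterate_lampPotential] at h4
  simp only [lampPotential, SemidirectProduct.one_left, toAdd_one, Finsupp.support_zero,
    Finset.sum_empty, zero_add] at h4
  rw [div_mul_eq_mul_div, one_mul, div_le_iff₀ (by positivity)]
  linarith

end Bubble

namespace Bubble

variable {α : ℕ → ℕ} (hα : ∀ k, 1 ≤ k → 1 ≤ α k)

/-! ### Words with a confined exponent sum of `a` -/

/-- The exponent of `a` in a generator. -/
def expo : Fin 4 → ℤ := ![1, -1, 0, 0]

/-- The action of a generator on three disjoint lines whose origins are permuted cyclically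
by `b`; this is the local picture of the bubble graph around a branching cycle. -/
def tripodStep (s : Fin 4) (t : Fin 3 × ℤ) : Fin 3 × ℤ :=
  (if t.2 = 0 then t.1 + ![0, 0, 1, 2] s else t.1, t.2 + expo s)

/-- `Confined m x g τ` says that `g` is the product of a word in the increments of the walk for
which the exponent sums of `a` in all prefixes are bounded by `m`; `x` is the exponent sum of the
whole word and `τ` describes its action on the tripod. -/
inductive Confined (m : ℕ) : ℤ → PermWreath (ZMod 2) (Vertex α) (BubbleGroup hα) →
    (Fin 3 × ℤ → Fin 3 × ℤ) → Prop
  | one : Confined m 0 1 id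
  | mul {x g τ} (ω : ZMod 2 × Fin 4 × ZMod 2) (h : Confined m x g τ)
      (hx : |x + expo ω.2.1| ≤ m) :
      Confined m (x + expo ω.2.1) (g * step hα ω) (τ ∘ tripodStep ω.2.1)

variable {hα} {m : ℕ} {x : ℤ} {g : PermWreath (ZMod 2) (Vertex α) (BubbleGroup hα)}
  {τ : Fin 3 × ℤ → Fin 3 × ℤ}

theorem Confined.abs_le (h : Confined hα m x g τ) : |x| ≤ m := by
  cases h with
  | one => simp
  | mul ω h hx => exact hx

theorem Confined.tripod_snd (h : Confined hα m x g τ) (t : Fin 3 × ℤ) : (τ t).2 = t.2 + x := by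
  induction h generalizing t with
  | one => simp
  | mul ω h hx ih =>
    rw [Function.comp_apply, ih, tripodStep]
    ring

theorem intCast_ne_middle {A : ℕ} {i : ℤ} (hi : |i| < A) :
    (i : ZMod (2 * A)) ≠ (A : ZMod (2 * A)) := by
  intro h
  rw [← Int.cast_natCast, ZMod.intCast_eq_intCast_iff_dvd_sub] at h
  rw [abs_lt] at hi
  have := Int.le_of_dvd (by omega) h
  push_cast at this
  omega

theorem intCast_eq_zero {A : ℕ} {i : ℤ} (hi : |i| < A) (h : (i : ZMod (2 * A)) = 0) : i = 0 := by
  rw [ZMod.intCast_zmod_eq_zero_iff_dvd] at h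
  refine Int.eq_zero_of_abs_lt_dvd h ?_
  push_cast
  have := abs_nonneg i
  omega

/-! ### The action near a branching cycle -/

/-- The map from the tripod to a neighbourhood of the branching cycle at the middle of `v`. -/
def tripodEmbed (α : ℕ → ℕ) (v : List Bool) (t : Fin 3 × ℤ) : Vertex α :=
  match t.1 with
  | 0 => ⟨v, (α (v.length + 1) : ZMod _) + (t.2 : ZMod _)⟩
  | 1 => ⟨false :: v, (t.2 : ZMod _)⟩
  | 2 => ⟨true :: v, (t.2 : ZMod _)⟩

/-- Closer to a branching cycle than the half-length of its three cycles, no other branching vertex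
is seen, so the picture is the same for all `v`. -/
theorem gen_smul_tripodEmbed (s : Fin 4) (v : List Bool) (t : Fin 3 × ℤ)
    (h1 : |t.2| < α (v.length + 1)) (h2 : |t.2| < α (v.length + 2)) :
    gen hα s • tripodEmbed α v t = tripodEmbed α v (tripodStep s t) := by
  have hm : tripodEmbed α v (0, 0) = middle α v := by simp [tripodEmbed, middle]
  have hf : tripodEmbed α v (1, 0) = start α (false :: v) := by simp [tripodEmbed, start]
  have ht : tripodEmbed α v (2, 0) = start α (true :: v) := by simp [tripodEmbed, start]
  have hb : t.2 ≠ 0 → bFun α (tripodEmbed α v t) = tripodEmbed α v t ∧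
      bInvFun α (tripodEmbed α v t) = tripodEmbed α v t := by
    obtain ⟨j, i⟩ := t
    intro hi
    have e1 : (α (v.length + 1) : ZMod (2 * α (v.length + 1))) + (i : ZMod _) ≠
        (α (v.length + 1) : ZMod _) := fun h =>
      hi (intCast_eq_zero h1 (by simpa using h))
    have e2 : (α (v.length + 1) : ZMod (2 * α (v.length + 1))) + (i : ZMod _) ≠ 0 := fun h => by
      refine intCast_ne_middle (i := -i) (by simpa using h1) ?_
      rw [Int.cast_neg]
      exact (eq_neg_of_add_eq_zero_left h).symm
    have e3 : (i : ZMod (2 * α (v.length + 2))) ≠ (α (v.length + 2) : ZMod _) :=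
      intCast_ne_middle h2
    have e4 : (i : ZMod (2 * α (v.length + 2))) ≠ 0 := fun h => hi (intCast_eq_zero h2 h)
    fin_cases j
    · exact ⟨bFun_other v _ e1 e2, bInvFun_other v _ e1 e2⟩
    · exact ⟨bFun_other (false :: v) _ e3 e4, bInvFun_other (false :: v) _ e3 e4⟩
    · exact ⟨bFun_other (true :: v) _ e3 e4, bInvFun_other (true :: v) _ e3 e4⟩
  obtain ⟨j, i⟩ := t
  by_cases hi : i = 0
  · subst hi
    fin_cases s
    · fin_cases j <;> simp [gen, tripodEmbed, tripodStep, expo, genA_smul]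
    · fin_cases j <;> simp [gen, tripodEmbed, tripodStep, expo, genA_inv_smul, sub_eq_add_neg]
    · have hs : ∀ j, tripodStep 2 (j, 0) = (j + 1, 0) := fun j => by simp [tripodStep, expo]
      show bFun α (tripodEmbed α v (j, 0)) = tripodEmbed α v (tripodStep 2 (j, 0))
      rw [hs]
      fin_cases j
      · exact (congrArg _ hm).trans ((bFun_middle v).trans hf.symm)
      · exact (congrArg _ hf).trans ((bFun_start_false hα v).trans ht.symm)
      · exact (congrArg _ ht).trans ((bFun_start_true hα v).trans hm.symm)
    · have hs : ∀ j, tripodStep 3 (j, 0) = (j + 2, 0) := fun j => by simp [tripodStep, expo]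
      show bInvFun α (tripodEmbed α v (j, 0)) = tripodEmbed α v (tripodStep 3 (j, 0))
      rw [hs]
      fin_cases j
      · exact (congrArg _ hm).trans ((bInvFun_middle v).trans ht.symm)
      · exact (congrArg _ hf).trans ((bInvFun_start_false hα v).trans hm.symm)
      · exact (congrArg _ ht).trans ((bInvFun_start_true hα v).trans hf.symm)
  · have hs : tripodStep s (j, i) = (j, i + expo s) := by simp [tripodStep, hi]
    rw [hs]
    fin_cases s
    · fin_cases j <;> simp [gen, tripodEmbed, expo, genA_smul, add_assoc]
    · fin_cases j <;> simp [gen, tripodEmbed, expo, genA_inv_smul, sub_eq_add_neg, add_assoc]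
    · simpa [expo, gen, genB_smul] using (hb hi).1
    · simpa [expo, gen, genB_inv_smul] using (hb hi).2

/-- The left action applies the last letter first. A suffix has exponent x minus that of a prefix,
so all intermediate coordinates are within m of `t.2 + x`, hence at most 4m in absolute value, and
the local picture stays valid. -/
theorem Confined.smul_tripodEmbed (h : Confined hα m x g τ) (v : List Bool)
    (h1 : 4 * m + 1 ≤ α (v.length + 1)) (h2 : 4 * m + 1 ≤ α (v.length + 2)) (t : Fin 3 × ℤ)
    (ht : |t.2 + x| ≤ 3 * m) : g.right • tripodEmbed α v t = tripodEmbed α v (τ t) := by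
  induction h generalizing t with
  | one => simp
  | @mul x g τ ω h hx ih =>
    have ht2 : |t.2| ≤ 4 * m := by
      rw [_root_.abs_le] at ht hx ⊢
      constructor <;> linarith
    rw [SemidirectProduct.mul_right, step_right, mul_smul, gen_smul_tripodEmbed _ _ _
      (by omega) (by omega), Function.comp_apply]
    -- The quantity `t.2 + x` is unchanged when the last letter is moved from the word to the point.
    refine ih _ ?_
    rwa [tripodStep, add_assoc, add_comm (expo _) x]

/-! ### The action away from the branching cycles -/

/-- The intermediate positions are `i + x` minus prefix exponents; if these avoid both branching
vertices of the cycle, every `b` acts trivially. -/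
theorem Confined.smul_of_far (h : Confined hα m x g τ) (w : List Bool)
    (i : ZMod (2 * α (w.length + 1)))
    (hi : ∀ z : ℤ, |z| ≤ m → i + ((x + z : ℤ) : ZMod (2 * α (w.length + 1))) ≠ 0 ∧
      i + ((x + z : ℤ) : ZMod (2 * α (w.length + 1))) ≠
        (α (w.length + 1) : ZMod (2 * α (w.length + 1)))) :
    g.right • (⟨w, i⟩ : Vertex α) = ⟨w, i + (x : ZMod _)⟩ := by
  induction h generalizing i with
  | one => simp
  | @mul x g τ ω h hx ih =>
    have hstep : gen hα ω.2.1 • (⟨w, i⟩ : Vertex α) = ⟨w, i + expo ω.2.1⟩ := by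
      have h0 := hi (-(x + expo ω.2.1)) (by rwa [abs_neg])
      rw [add_neg_cancel, Int.cast_zero, add_zero] at h0
      obtain ⟨l, s, l'⟩ := ω
      fin_cases s
      · simp [gen, expo, genA_smul]
      · simp [gen, expo, genA_inv_smul, sub_eq_add_neg]
      · simpa [expo, gen, genB_smul] using bFun_other w i h0.2 h0.1
      · simpa [expo, gen, genB_inv_smul] using bInvFun_other w i h0.2 h0.1
    have hsum : ∀ z : ℤ,
        i + (expo ω.2.1 : ZMod (2 * α (w.length + 1))) + ((x + z : ℤ) : ZMod _) =
        i + ((x + expo ω.2.1 + z : ℤ) : ZMod (2 * α (w.length + 1))) := by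
      intro z
      push_cast
      ring
    have hsum0 := hsum 0
    rw [add_zero, add_zero] at hsum0
    rw [SemidirectProduct.mul_right, step_right, mul_smul, hstep, ih _ ?_, hsum0]
    intro z hz
    rw [hsum]
    exact hi z hz

/-! ### The action on the first levels -/

/-- The points of the bubble graph that a confined word with exponent sum `x` does not move below
the cycles indexed by words of length `L`. -/
def Shallow (L m : ℕ) (x : ℤ) (y : Vertex α) : Prop :=
  y.1.length < L ∨ (y.1.length = L ∧ ∃ c : ℤ, |c| ≤ 3 * m ∧ y.2 = ((c - x : ℤ) : ZMod _))

theorem Shallow.a {L : ℕ} {y : Vertex α} (h : Shallow L m (x + 1) y) :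
    Shallow L m x (genA hα • y) := by
  obtain ⟨w, i⟩ := y
  rcases h with h | ⟨h, c, hc, hi⟩
  · exact Or.inl h
  · refine Or.inr ⟨h, c, hc, ?_⟩
    dsimp only at hi
    rw [genA_smul, hi]
    push_cast
    ring

theorem Shallow.a_inv {L : ℕ} {y : Vertex α} (h : Shallow L m (x + -1) y) :
    Shallow L m x ((genA hα)⁻¹ • y) := by
  obtain ⟨w, i⟩ := y
  rw [genA_inv_smul]
  rcases h with h | ⟨h, c, hc, hi⟩
  · exact Or.inl h
  · refine Or.inr ⟨h, c, hc, ?_⟩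
    dsimp only at hi ⊢
    rw [hi]
    push_cast
    ring

theorem shallow_start {L : ℕ} {w : List Bool} (hx : |x| ≤ m) (hw : w.length ≤ L) :
    Shallow L m x (start α w) := by
  rcases hw.lt_or_eq with h | h
  · exact Or.inl h
  · exact Or.inr ⟨h, x, by omega, by rw [sub_self, Int.cast_zero]; rfl⟩

theorem Shallow.length_le {L : ℕ} {y : Vertex α} (h : Shallow L m x y) : y.1.length ≤ L := by
  rcases h with h | h
  · exact h.le
  · exact h.1.le

/-- On a cycle indexed by a word of length L the point is within 4m of the start, which is short of
the middle. So the exit to deeper cycles is never reached. -/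
theorem Shallow.length_lt_of_middle {L : ℕ} {w : List Bool} (hL : 4 * m + 1 ≤ α (L + 1))
    (hx : |x| ≤ m) (h : Shallow L m x (middle α w)) : w.length < L := by
  rcases h with h | ⟨rfl, c, hc, hi⟩
  · exact h
  · refine absurd hi.symm (intCast_ne_middle ?_)
    have := abs_sub c x
    have e : α ((middle α w).1.length + 1) = α (w.length + 1) := rfl
    omega

theorem Shallow.b (hα : ∀ k, 1 ≤ k → 1 ≤ α k) {L : ℕ} {y : Vertex α} (hL : 4 * m + 1 ≤ α (L + 1)) (hx : |x| ≤ m)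
    (h : Shallow L m x y) : Shallow L m x (bFun α y) ∧ Shallow L m x (bInvFun α y) := by
  induction y using vertex_cases with
  | h_root => rw [bFun_root hα, bInvFun_root hα]; exact ⟨h, h⟩
  | h_middle w =>
    have hw := h.length_lt_of_middle hL hx
    rw [bFun_middle, bInvFun_middle]
    exact ⟨shallow_start hx hw, shallow_start hx hw⟩
  | h_false w =>
    have hw := h.length_le
    rw [bFun_start_false hα, bInvFun_start_false hα]
    exact ⟨shallow_start hx hw, Or.inl hw⟩
  | h_true w =>
    have hw := h.length_le
    rw [bFun_start_true hα, bInvFun_start_true hα]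
    exact ⟨Or.inl hw, shallow_start hx hw⟩
  | h_other w i h1 h0 =>
    rw [bFun_other w i h1 h0, bInvFun_other w i h1 h0]
    exact ⟨h, h⟩

theorem Confined.length_smul_le (h : Confined hα m x g τ) {L : ℕ} (hL : 4 * m + 1 ≤ α (L + 1))
    {y : Vertex α} (hy : Shallow L m x y) : (g.right • y).1.length ≤ L := by
  induction h generalizing y with
  | one => simpa using hy.length_le
  | @mul x g τ ω h hx ih =>
    rw [SemidirectProduct.mul_right, step_right, mul_smul]
    refine ih ?_
    obtain ⟨l, s, l'⟩ := ω
    fin_cases s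
    · exact Shallow.a hy
    · exact Shallow.a_inv hy
    · have hy' : Shallow L m x y := by simpa [expo] using hy
      exact (Shallow.b hα hL h.abs_le hy').1
    · have hy' : Shallow L m x y := by simpa [expo] using hy
      exact (Shallow.b hα hL h.abs_le hy').2

/-- Switches happen at the images of the root under prefixes, which are confined words themselves,
and the root is shallow since L > 0. -/
theorem Confined.lamp_eq_zero (h : Confined hα m x g τ) {L : ℕ} (hL0 : 0 < L)
    (hL : 4 * m + 1 ≤ α (L + 1)) {y : Vertex α} (hy : L < y.1.length) :
    Multiplicative.toAdd g.left y = 0 := by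
  have key : ∀ {x g τ}, Confined hα m x g τ → g.right⁻¹ • y ≠ root α := by
    intro x g τ h hr
    rw [inv_smul_eq_iff] at hr
    have := h.length_smul_le hL (y := root α) (Or.inl hL0)
    rw [← hr] at this
    omega
  induction h with
  | one => simp
  | @mul x g τ ω h hx ih =>
    rw [mul_step_left_apply, ih, Finsupp.single_eq_of_ne (key h), Finsupp.single_eq_of_ne]
    · simp
    · have := key (Confined.mul ω h hx)
      rwa [SemidirectProduct.mul_right, step_right] at this

end Bubble

namespace Bubble

variable {α : ℕ → ℕ} {hα : ∀ k, 1 ≤ k → 1 ≤ α k} {m L : ℕ} {x : ℤ}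
  {g g' : PermWreath (ZMod 2) (Vertex α) (BubbleGroup hα)} {τ τ' : Fin 3 × ℤ → Fin 3 × ℤ}

/-! ### Counting confined elements -/

/-- Every vertex is shallow, or within 2m of a branching cycle at depth at least L, or far from both
branching vertices of its cycle. The three cases are settled by `h1`, by the tripod data `h2`, and
by the common translation x. -/
theorem Confined.smul_eq_smul (h : Confined hα m x g τ) (h' : Confined hα m x g' τ')
    (hL : ∀ l, L ≤ l → 4 * m + 1 ≤ α (l + 1))
    (h1 : ∀ y : Vertex α, y.1.length ≤ L → (g.right • y).1.length ≤ L →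
      (g'.right • y).1.length ≤ L → g.right • y = g'.right • y)
    (h2 : ∀ j (i : ℤ), |i| ≤ 2 * m → (τ (j, i)).1 = (τ' (j, i)).1) (y : Vertex α) :
    g.right • y = g'.right • y := by
  have hx := h.abs_le
  have shallow : ∀ y, Shallow L m x y → g.right • y = g'.right • y := fun y hy =>
    h1 y hy.length_le (h.length_smul_le (hL L le_rfl) hy) (h'.length_smul_le (hL L le_rfl) hy)
  have tripod : ∀ v : List Bool, L ≤ v.length → ∀ j (i : ℤ), |i| ≤ 2 * m →
      g.right • tripodEmbed α v (j, i) = g'.right • tripodEmbed α v (j, i) := by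
    intro v hv j i hi
    have hix : |i + x| ≤ 3 * m := (abs_add_le i x).trans (by omega)
    have hτ : τ (j, i) = τ' (j, i) :=
      Prod.ext (h2 j i hi) ((h.tripod_snd _).trans (h'.tripod_snd _).symm)
    rw [h.smul_tripodEmbed v (hL _ hv) (hL _ (by omega)) _ hix,
      h'.smul_tripodEmbed v (hL _ hv) (hL _ (by omega)) _ hix, hτ]
  obtain ⟨w, i⟩ := y
  rcases lt_or_ge w.length L with hw | hw
  · exact shallow _ (Or.inl hw)
  by_cases hm : ∃ z : ℤ, |z| ≤ 2 * m ∧ i = (α (w.length + 1) : ZMod _) + (z : ZMod _)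
  · obtain ⟨z, hz, rfl⟩ := hm
    exact tripod w hw 0 z hz
  by_cases h0 : ∃ z : ℤ, |z| ≤ 2 * m ∧ i = (z : ZMod _)
  · obtain ⟨z, hz, rfl⟩ := h0
    rcases hw.eq_or_lt with hw | hw
    · refine shallow _ (Or.inr ⟨hw.symm, z + x, (abs_add_le z x).trans (by omega), ?_⟩)
      rw [add_sub_cancel_right]
    · cases w with
      | nil => simp at hw
      | cons c v =>
        have hv : L ≤ v.length := Nat.lt_succ_iff.1 hw
        cases c with
        | false => exact tripod v hv 1 z hz
        | true => exact tripod v hv 2 z hz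
  · push Not at hm h0
    have far : ∀ z : ℤ, |z| ≤ m → i + ((x + z : ℤ) : ZMod (2 * α (w.length + 1))) ≠ 0 ∧
        i + ((x + z : ℤ) : ZMod (2 * α (w.length + 1))) ≠
          (α (w.length + 1) : ZMod (2 * α (w.length + 1))) := by
      intro z hz
      have hxz : |-(x + z)| ≤ 2 * m := by
        rw [abs_neg]
        exact (abs_add_le x z).trans (by omega)
      refine ⟨fun e => h0 _ hxz ?_, fun e => hm _ hxz ?_⟩
      · rw [Int.cast_neg]
        exact eq_neg_of_add_eq_zero_left e
      · rw [Int.cast_neg, ← e, add_neg_cancel_right]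
    rw [h.smul_of_far w i far, h'.smul_of_far w i far]

theorem Confined.eq_of (h : Confined hα m x g τ) (h' : Confined hα m x g' τ') (hL0 : 0 < L)
    (hL : ∀ l, L ≤ l → 4 * m + 1 ≤ α (l + 1))
    (h1 : ∀ y : Vertex α, y.1.length ≤ L → (g.right • y).1.length ≤ L →
      (g'.right • y).1.length ≤ L → g.right • y = g'.right • y)
    (h2 : ∀ j (i : ℤ), |i| ≤ 2 * m → (τ (j, i)).1 = (τ' (j, i)).1)
    (h3 : ∀ y : Vertex α, y.1.length ≤ L →
      Multiplicative.toAdd g.left y = Multiplicative.toAdd g'.left y) : g = g' := by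
  refine SemidirectProduct.ext ?_ (Subtype.ext (Equiv.ext fun y =>
    h.smul_eq_smul h' hL h1 h2 y))
  refine Multiplicative.toAdd.injective (Finsupp.ext fun y => ?_)
  rcases le_or_gt y.1.length L with hy | hy
  · exact h3 y hy
  · rw [h.lamp_eq_zero hL0 (hL L le_rfl) hy, h'.lamp_eq_zero hL0 (hL L le_rfl) hy]

/-- The words of length at most `L`. -/
def words : ℕ → Finset (List Bool)
  | 0 => {[]}
  | L + 1 => insert [] ((words L).image (List.cons false) ∪ (words L).image (List.cons true))

theorem mem_words {L : ℕ} {w : List Bool} : w ∈ words L ↔ w.length ≤ L := by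
  induction L generalizing w with
  | zero => simp [words]
  | succ L ih =>
    rcases w with _ | ⟨_ | _, v⟩ <;> simp [words, ih]

theorem card_words_lt (L : ℕ) : (words L).card < 2 ^ (L + 1) := by
  induction L with
  | zero => simp [words]
  | succ L ih =>
    have h1 := Finset.card_insert_le ([] : List Bool)
      ((words L).image (List.cons false) ∪ (words L).image (List.cons true))
    have h2 := Finset.card_union_le ((words L).image (List.cons false))
      ((words L).image (List.cons true))
    have h3 := Finset.card_image_le (s := words L) (f := List.cons false)
    have h4 := Finset.card_image_le (s := words L) (f := List.cons true)
    rw [pow_succ]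
    simp only [words]
    omega

/-- The vertices on the cycles that are indexed by words of length at most `L`. -/
def ball (α : ℕ → ℕ) (L : ℕ) : Finset (Vertex α) :=
  (words L).sigma fun w =>
    (Finset.range (2 * α (w.length + 1))).image fun n : ℕ => (n : ZMod (2 * α (w.length + 1)))

theorem mem_ball (hα : ∀ k, 1 ≤ k → 1 ≤ α k) {y : Vertex α} :
    y ∈ ball α L ↔ y.1.length ≤ L := by
  rw [ball, Finset.mem_sigma, mem_words, and_iff_left]
  have : NeZero (2 * α (y.1.length + 1)) :=
    ⟨by have := hα (y.1.length + 1) (by omega); omega⟩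
  exact Finset.mem_image.2 ⟨y.2.val, Finset.mem_range.2 (ZMod.val_lt y.2),
    ZMod.natCast_zmod_val y.2⟩

theorem card_ball_le {M : ℕ} (hM : ∀ l, l ≤ L → α (l + 1) ≤ M) :
    (ball α L).card ≤ 2 ^ (L + 1) * (2 * M) := by
  rw [ball, Finset.card_sigma]
  calc _ ≤ ∑ w ∈ words L, 2 * M := Finset.sum_le_sum fun w hw => by
        refine Finset.card_image_le.trans ?_
        rw [Finset.card_range]
        exact Nat.mul_le_mul_left 2 (hM _ (mem_words.1 hw))
    _ = (words L).card * (2 * M) := by rw [Finset.sum_const, smul_eq_mul]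
    _ ≤ _ := Nat.mul_le_mul_right _ (card_words_lt L).le

/-- A bound for the number of confined elements. -/
def codeCard (α : ℕ → ℕ) (L m : ℕ) : ℕ :=
  (2 * m + 1) * (2 ^ (ball α L).card * ((ball α L).card ^ (ball α L).card *
    3 ^ (3 * (4 * m + 1))))

theorem exists_finset_confined (hα : ∀ k, 1 ≤ k → 1 ≤ α k) (hL0 : 0 < L)
    (hL : ∀ l, L ≤ l → 4 * m + 1 ≤ α (l + 1)) :
    ∃ A : Finset (PermWreath (ZMod 2) (Vertex α) (BubbleGroup hα)),
      (∀ x g τ, Confined hα m x g τ → g ∈ A) ∧ A.card ≤ codeCard α L m := by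
  classical
  set E := {g : PermWreath (ZMod 2) (Vertex α) (BubbleGroup hα) | ∃ x τ, Confined hα m x g τ}
  have hE : ∀ g : E, ∃ x τ, Confined hα m x g.1 τ := fun g => g.2
  choose X T hXT using hE
  let code : E → Finset.Icc (-m : ℤ) m × (ball α L → ZMod 2) × (ball α L → ball α L) ×
      (Fin 3 × Finset.Icc (-(2 * m) : ℤ) (2 * m) → Fin 3) := fun g =>
    (⟨X g, Finset.mem_Icc.2 (abs_le.1 (hXT g).abs_le)⟩,
      fun y => Multiplicative.toAdd g.1.left y,
      -- The default `y` is harmless: actions are only compared where both images lie in the ball.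
      fun y => if h : g.1.right • y.1 ∈ ball α L then ⟨g.1.right • y.1, h⟩ else y,
      fun t => (T g (t.1, t.2)).1)
  have hcode : Function.Injective code := by
    intro g g' h
    simp only [code, Prod.mk.injEq, Subtype.mk.injEq] at h
    obtain ⟨e1, e2, e3, e4⟩ := h
    have h' := hXT g'
    rw [← e1] at h'
    refine Subtype.ext ((hXT g).eq_of h' hL0 hL ?_ ?_ ?_)
    · intro y hy hg hg'
      have := congrFun e3 ⟨y, (mem_ball hα).2 hy⟩
      rw [dif_pos ((mem_ball hα).2 hg), dif_pos ((mem_ball hα).2 hg')] at this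
      exact congrArg Subtype.val this
    · intro j i hi
      exact congrFun e4 (j, ⟨i, Finset.mem_Icc.2 (abs_le.1 hi)⟩)
    · intro y hy
      exact congrFun e2 ⟨y, (mem_ball hα).2 hy⟩
  have hfin : Finite E := Finite.of_injective code hcode
  have hEf : E.Finite := hfin
  refine ⟨hEf.toFinset, fun x g τ h => hEf.mem_toFinset.2 ⟨x, τ, h⟩, ?_⟩
  rw [← Set.ncard_eq_toFinset_card E hEf]
  refine (Nat.card_le_card_of_injective code hcode).trans (le_of_eq ?_)
  rw [Nat.card_eq_fintype_card]
  simp only [Fintype.card_prod, Fintype.card_fun, Fintype.card_coe, Int.card_Icc, Fintype.card_fin,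
    ZMod.card, codeCard]
  have e1 : ((m : ℤ) + 1 - -m).toNat = 2 * m + 1 := by omega
  have e2 : ((2 * m : ℤ) + 1 - -(2 * m)).toNat = 4 * m + 1 := by omega
  rw [e1, e2]

/-! ### The probability of confinement -/

theorem markov_iterate_nonneg {F : PermWreath (ZMod 2) (Vertex α) (BubbleGroup hα) → ℝ}
    (hF : ∀ g, 0 ≤ F g) (n : ℕ) (g : PermWreath (ZMod 2) (Vertex α) (BubbleGroup hα)) :
    0 ≤ (RandomWalk.markov (step hα))^[n] F g := by
  induction n generalizing g with
  | zero => exact hF g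
  | succ n ih =>
    rw [Function.iterate_succ_apply', RandomWalk.markov]
    exact div_nonneg (Finset.sum_nonneg fun ω _ => ih _) (Nat.cast_nonneg _)

/-- The exponent moves by 1 or -1 with probability 1/4 each and otherwise rests, so this cosine is
an eigenfunction with eigenvalue (1 + cos θ)/2. -/
theorem sum_cos_expo (θ : ℝ) (x : ℤ) :
    ∑ ω : ZMod 2 × Fin 4 × ZMod 2, Real.cos (θ * ((x + expo ω.2.1 : ℤ) : ℝ)) =
      16 * ((1 + Real.cos θ) / 2 * Real.cos (θ * x)) := by
  simp only [Fintype.sum_prod_type, Finset.sum_const, Finset.card_univ, ZMod.card,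
    Fin.sum_univ_four, expo, Matrix.cons_val_zero, Matrix.cons_val_one, Matrix.cons_val]
  push_cast
  rw [mul_add, mul_add, Real.cos_add, Real.cos_add]
  simp
  ring

/-- Comparison with the Dirichlet eigenfunction of [-m, m]: θ is chosen so that the cosine vanishes
at ±(m + 1), where confinement first fails. -/
theorem Confined.le_markov_iterate {A : Finset (PermWreath (ZMod 2) (Vertex α) (BubbleGroup hα))}
    [DecidableEq (PermWreath (ZMod 2) (Vertex α) (BubbleGroup hα))]
    (hA : ∀ x g τ, Confined hα m x g τ → g ∈ A) {θ : ℝ} (hθ : θ * (m + 1) = Real.pi / 2)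
    (n : ℕ) (h : Confined hα m x g τ) :
    ((1 + Real.cos θ) / 2) ^ n * Real.cos (θ * x) ≤
      (RandomWalk.markov (step hα))^[n] (fun g => if g ∈ A then 1 else 0) g := by
  induction n generalizing x g τ with
  | zero => simpa [hA _ _ _ h] using Real.cos_le_one _
  | succ n ih =>
    have hterm : ∀ ω : ZMod 2 × Fin 4 × ZMod 2,
        ((1 + Real.cos θ) / 2) ^ n * Real.cos (θ * ((x + expo ω.2.1 : ℤ) : ℝ)) ≤
          (RandomWalk.markov (step hα))^[n] (fun g => if g ∈ A then 1 else 0) (g * step hα ω) := by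
      intro ω
      by_cases hx : |x + expo ω.2.1| ≤ m
      · exact ih (h.mul ω hx)
      · have he : |expo ω.2.1| ≤ 1 := by
          generalize ω.2.1 = s
          fin_cases s <;> simp [expo]
        have hcos : Real.cos (θ * ((x + expo ω.2.1 : ℤ) : ℝ)) = 0 := by
          have hxm := h.abs_le
          have h1 := abs_add_le x (expo ω.2.1)
          -- Steps have size at most 1, so the interval is left exactly at a zero of the cosine.
          have h2 : |x + expo ω.2.1| = m + 1 := by omega
          rw [← Real.cos_abs, abs_mul, ← Int.cast_abs, h2, Int.cast_add, Int.cast_natCast,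
            Int.cast_one, ← abs_of_nonneg (show (0 : ℝ) ≤ m + 1 by positivity), ← abs_mul, hθ,
            Real.cos_abs, Real.cos_pi_div_two]
        rw [hcos, mul_zero]
        exact markov_iterate_nonneg (fun g => by split_ifs <;> norm_num) n _
    rw [Function.iterate_succ_apply', RandomWalk.markov]
    have hcard : (Fintype.card (ZMod 2 × Fin 4 × ZMod 2) : ℝ) = 16 := by simp
    rw [hcard, le_div_iff₀ (by norm_num)]
    calc _ = ∑ ω : ZMod 2 × Fin 4 × ZMod 2, ((1 + Real.cos θ) / 2) ^ n *
          Real.cos (θ * ((x + expo ω.2.1 : ℤ) : ℝ)) := by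
          rw [← Finset.mul_sum, sum_cos_expo]
          ring
      _ ≤ _ := Finset.sum_le_sum fun ω _ => hterm ω

/-- The first term is the cost of confinement, squared by Cauchy–Schwarz; the second is the entropy
of the confined elements. -/
theorem abs_log_returnProb_le (hα : ∀ k, 1 ≤ k → 1 ≤ α k) (hL0 : 0 < L)
    (hL : ∀ l, L ≤ l → 4 * m + 1 ≤ α (l + 1)) (n : ℕ) :
    |Real.log (RandomWalk.returnProb
      ((PMF.uniformOfFintype (ZMod 2 × Fin 4 × ZMod 2)).map (step hα)) (2 * n))| ≤
      4 * n / (m + 1) ^ 2 + Real.log (codeCard α L m) := by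
  classical
  set p := RandomWalk.returnProb
      ((PMF.uniformOfFintype (ZMod 2 × Fin 4 × ZMod 2)).map (step hα)) (2 * n) with hp
  obtain ⟨A, hA, hcard⟩ := exists_finset_confined hα hL0 hL
  have hm : (0 : ℝ) < m + 1 := by positivity
  set θ : ℝ := Real.pi / 2 / (m + 1) with hθ
  set c : ℝ := (1 + Real.cos θ) / 2 with hc
  have hθ0 : 0 < θ := by positivity
  have hθ1 : θ ≤ Real.pi / 2 := div_le_self (by positivity) (by simp)
  have hc2 : 1 / 2 ≤ c := by
    have := Real.cos_nonneg_of_neg_pi_div_two_le_of_le (by linarith) hθ1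
    rw [hc]
    linarith
  have hc0 : 0 < c := by linarith
  have hlogc : -(2 / (m + 1) ^ 2) ≤ Real.log c := by
    have h1 : 1 - θ ^ 2 / 4 ≤ c := by
      have := Real.one_sub_sq_div_two_le_cos (x := θ)
      rw [hc]
      linarith
    have h2 : θ ^ 2 ≤ 4 / (m + 1) ^ 2 := by
      rw [hθ, div_pow]
      gcongr
      nlinarith [Real.pi_pos, Real.pi_lt_four]
    have h3 : 1 - c⁻¹ ≤ Real.log c := Real.one_sub_inv_le_log_of_pos hc0
    have h4 : -(2 * (1 - c)) ≤ 1 - c⁻¹ := by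
      have hc1 : c ≤ 1 := by
        rw [hc]
        linarith [Real.cos_le_one θ]
      -- Since c ≥ 1/2, dividing by c costs at most a factor 2.
      have : 1 - c⁻¹ = -((1 - c) / c) := by field_simp; ring
      rw [this, neg_le_neg_iff, div_le_iff₀ hc0]
      nlinarith
    have h5 : 4 / ((m : ℝ) + 1) ^ 2 = 2 * (2 / (m + 1) ^ 2) := by ring
    linarith
  have hprob : c ^ n ≤ ∑ g ∈ A, (RandomWalk.law
      ((PMF.uniformOfFintype (ZMod 2 × Fin 4 × ZMod 2)).map (step hα)) n g).toReal := by
    rw [RandomWalk.sum_law_eq]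
    have := Confined.le_markov_iterate hA (show θ * (m + 1) = Real.pi / 2 by
      rw [hθ]; field_simp) n (Confined.one (hα := hα) (m := m))
    simpa using this
  have hret := RandomWalk.sq_sum_law_le (step hα) stepSymm (step_stepSymm hα) n A
  rw [← hp] at hret
  have hp0 : 0 ≤ p := ENNReal.toReal_nonneg
  have hp1 : p ≤ 1 := by
    have := ENNReal.toReal_mono ENNReal.one_ne_top (PMF.coe_le_one (RandomWalk.law
      ((PMF.uniformOfFintype (ZMod 2 × Fin 4 × ZMod 2)).map (step hα)) (2 * n)) 1)
    exact this.trans_eq ENNReal.toReal_one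
  have hmain : (c ^ n) ^ 2 ≤ codeCard α L m * p := by
    calc (c ^ n) ^ 2 ≤ _ := by gcongr
      _ ≤ _ := hret
      _ ≤ _ := by gcongr
  have hpos : 0 < (codeCard α L m : ℝ) * p := lt_of_lt_of_le (by positivity) hmain
  have hN0 : (codeCard α L m : ℝ) ≠ 0 := left_ne_zero_of_mul hpos.ne'
  have hp0' : p ≠ 0 := right_ne_zero_of_mul hpos.ne'
  have hlog := Real.log_le_log (by positivity) hmain
  rw [Real.log_mul hN0 hp0', Real.log_pow, Real.log_pow] at hlog
  rw [abs_of_nonpos (Real.log_nonpos hp0 hp1)]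
  have h6 : 4 * (n : ℝ) / (m + 1) ^ 2 = 2 * (n * (2 / (m + 1) ^ 2)) := by ring
  have h7 : (n : ℝ) * -(2 / (m + 1) ^ 2) ≤ n * Real.log c := by gcongr
  push_cast at hlog
  linarith

end Bubble

namespace Bubble

/-! ### The scaling sequence -/

theorem scaling_le_two_pow {k : ℕ} (hk : 1 ≤ k) : scaling k ≤ 2 ^ k := by
  refine Nat.ceil_le.2 ?_
  push_cast
  refine div_le_self (by positivity) ?_
  have : (1 : ℚ) ≤ k := by exact_mod_cast hk
  nlinarith

theorem div_sq_le_scaling (k : ℕ) : (2 : ℝ) ^ k / (k : ℝ) ^ 2 ≤ scaling k := by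
  have h : (2 : ℚ) ^ k / (k : ℚ) ^ 2 ≤ scaling k := Nat.le_ceil _
  have h' : (((2 : ℚ) ^ k / (k : ℚ) ^ 2 : ℚ) : ℝ) ≤ ((scaling k : ℚ) : ℝ) := by exact_mod_cast h
  simpa using h'

theorem scaling_le (k : ℕ) : (scaling k : ℝ) ≤ (2 : ℝ) ^ k / (k : ℝ) ^ 2 + 1 := by
  have h : (scaling k : ℚ) < (2 : ℚ) ^ k / (k : ℚ) ^ 2 + 1 := Nat.ceil_lt_add_one (by positivity)
  have h' : ((scaling k : ℚ) : ℝ) < (((2 : ℚ) ^ k / (k : ℚ) ^ 2 + 1 : ℚ) : ℝ) := by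
    exact_mod_cast h
  simpa using h'.le

theorem two_pow_div_sq_mono {k l : ℕ} (hk : 3 ≤ k) (hkl : k ≤ l) :
    (2 : ℝ) ^ k / (k : ℝ) ^ 2 ≤ (2 : ℝ) ^ l / (l : ℝ) ^ 2 := by
  induction l, hkl using Nat.le_induction with
  | base => exact le_rfl
  | succ l hl ih =>
    refine ih.trans ?_
    have h3 : (3 : ℝ) ≤ l := by exact_mod_cast hk.trans hl
    have h0 : (0 : ℝ) < l := by linarith
    rw [div_le_div_iff₀ (by positivity) (by positivity), pow_succ 2 l, mul_assoc]
    push_cast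
    gcongr
    nlinarith

/-- Finite resistance to infinity: the summands are at most 1/k² plus a geometric term that absorbs
the rounding and the `b`-edge. -/
theorem exists_sum_scaling_le :
    ∃ U : ℝ, ∀ n, ∑ j ∈ Finset.range n, ((scaling (j + 1) : ℝ) + 1) / 2 ^ (j + 1) ≤ U := by
  have hs : Summable fun j : ℕ => 1 / ((j + 1 : ℕ) : ℝ) ^ 2 + (1 / 2 : ℝ) ^ j :=
    ((summable_nat_add_iff 1).2 (Real.summable_one_div_nat_pow.2 one_lt_two)).add
      summable_geometric_two
  refine ⟨_, fun n => (Finset.sum_le_sum fun j _ => ?_).trans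
    (hs.sum_le_tsum (Finset.range n) fun j _ => by positivity)⟩
  have h := scaling_le (j + 1)
  rw [div_le_iff₀ (by positivity)]
  have e : (1 / ((j + 1 : ℕ) : ℝ) ^ 2 + (1 / 2 : ℝ) ^ j) * 2 ^ (j + 1) =
      2 ^ (j + 1) / ((j + 1 : ℕ) : ℝ) ^ 2 + 2 := by
    have : (1 / 2 : ℝ) ^ j * 2 ^ (j + 1) = 2 := by
      rw [pow_succ, ← mul_assoc, ← mul_pow]
      norm_num
    rw [add_mul, this]
    ring
  linarith

/-! ### The return probability -/

/-- The ball has at most 2 · 4^k vertices (2^k cycles of length at most 2 · 2^k), and the dominant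
term is b log b, from the self-maps of the ball. -/
theorem log_codeCard_scaling_le {k m : ℕ} (hk : 1 ≤ k) (hm : m ≤ 2 ^ k) :
    Real.log (codeCard scaling (k - 1) m) ≤ 40 * (4 ^ k * k) := by
  set b := (ball scaling (k - 1)).card with hb
  have hk' : (1 : ℝ) ≤ k := by exact_mod_cast hk
  have hN1 : (1 : ℝ) ≤ 4 ^ k := one_le_pow₀ (by norm_num)
  have hmN : (m : ℝ) ≤ 4 ^ k := by
    calc (m : ℝ) ≤ 2 ^ k := by exact_mod_cast hm
      _ ≤ 4 ^ k := by gcongr; norm_num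
  have hb2 : b ≤ 2 * 4 ^ k := by
    have := card_ball_le (α := scaling) (L := k - 1) (M := 2 ^ k) fun l hl =>
      (scaling_le_two_pow (by omega)).trans (Nat.pow_le_pow_right (by norm_num) (by omega))
    rw [Nat.sub_add_cancel hk] at this
    calc b ≤ _ := this
      _ = 2 * 4 ^ k := by
        rw [show (4 : ℕ) = 2 * 2 by norm_num, mul_pow]
        ring
  have hb2' : (b : ℝ) ≤ 2 * 4 ^ k := by exact_mod_cast hb2
  have hb0 : 0 < b :=
    Finset.card_pos.2 ⟨root scaling, (mem_ball one_le_scaling).2 (Nat.zero_le _)⟩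
  have hb0' : (0 : ℝ) < b := by exact_mod_cast hb0
  have hlog2 : Real.log 2 ≤ 1 := by linarith [Real.log_two_lt_d9]
  have hlog3 : Real.log 3 ≤ 2 := by
    linarith [Real.log_le_sub_one_of_pos (show (0 : ℝ) < 3 by norm_num)]
  have hlogb : Real.log b ≤ 1 + 2 * k := by
    refine (Real.log_le_log hb0' hb2').trans ?_
    rw [Real.log_mul (by norm_num) (by positivity), Real.log_pow,
      show (4 : ℝ) = 2 ^ 2 by norm_num, Real.log_pow]
    push_cast
    nlinarith
  have hlogm : Real.log (2 * m + 1) ≤ 2 * m := by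
    have := Real.log_le_sub_one_of_pos (show (0 : ℝ) < 2 * m + 1 by positivity)
    linarith
  have e : Real.log (codeCard scaling (k - 1) m) =
      Real.log (2 * m + 1) +
        (b * Real.log 2 + (b * Real.log b + (3 * (4 * m + 1)) * Real.log 3)) := by
    rw [codeCard, ← hb]
    push_cast
    rw [Real.log_mul (by positivity) (by positivity), Real.log_mul (by positivity) (by positivity),
      Real.log_mul (by positivity) (by positivity), Real.log_pow, Real.log_pow, Real.log_pow]
    push_cast
    rfl
  have h1 : (b : ℝ) * Real.log 2 ≤ 2 * 4 ^ k * 1 := by gcongr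
  have h2 : (b : ℝ) * Real.log b ≤ 2 * 4 ^ k * (1 + 2 * k) := by
    have : (0 : ℝ) ≤ Real.log b := Real.log_natCast_nonneg b
    gcongr
  have h3 : (3 * (4 * (m : ℝ) + 1)) * Real.log 3 ≤ 3 * (4 * 4 ^ k + 4 ^ k) * 2 := by gcongr
  rw [e]
  nlinarith

theorem abs_log_returnProb_stepLaw_le {k n : ℕ} (hk : 3 ≤ k) (hn : n ≤ 16 ^ (k + 1)) :
    |Real.log (RandomWalk.returnProb stepLaw (2 * n))| ≤ 1640 * (4 ^ k * k ^ 4) := by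
  have hk0 : (0 : ℝ) < k := by exact_mod_cast (by omega : 0 < k)
  have hk1 : (1 : ℝ) ≤ k := by exact_mod_cast (by omega : 1 ≤ k)
  -- The 5 makes `4 * m + 1 ≤ 5 * m ≤ scaling (l + 1)` for m ≥ 1; for m = 0 only `1 ≤ scaling (l +
  -- 1)` is needed.
  set q : ℝ := 2 ^ k / (k : ℝ) ^ 2 / 5 with hq
  have hq0 : 0 < q := by positivity
  set m := ⌊q⌋₊ with hm
  have hmq : (m : ℝ) ≤ q := Nat.floor_le hq0.le
  have hqm : q < m + 1 := Nat.lt_floor_add_one q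
  have hL : ∀ l, k - 1 ≤ l → 4 * m + 1 ≤ scaling (l + 1) := by
    intro l hl
    rcases Nat.eq_zero_or_pos m with h0 | h0
    · rw [h0]
      exact one_le_scaling _ (by omega)
    · have h1 := (two_pow_div_sq_mono hk (show k ≤ l + 1 by omega)).trans (div_sq_le_scaling _)
      have h2 : (5 * m : ℝ) ≤ scaling (l + 1) := by
        refine le_trans ?_ h1
        rw [hq] at hmq
        linarith
      have h3 : 5 * m ≤ scaling (l + 1) := by exact_mod_cast h2
      omega
  have hm2 : m ≤ 2 ^ k := by
    have : q ≤ 2 ^ k := by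
      rw [hq, div_div]
      exact div_le_self (by positivity) (by nlinarith)
    exact_mod_cast hmq.trans this
  have h1 := abs_log_returnProb_le one_le_scaling (show 0 < k - 1 by omega) hL n
  rw [← switchWalkSwitch_eq_map] at h1
  refine h1.trans ?_
  have h2 := log_codeCard_scaling_le (show 1 ≤ k by omega) hm2
  have h3 : 4 * (n : ℝ) / (m + 1) ^ 2 ≤ 1600 * (4 ^ k * (k : ℝ) ^ 4) := by
    have hn' : (n : ℝ) ≤ 16 ^ (k + 1) := by exact_mod_cast hn
    calc 4 * (n : ℝ) / (m + 1) ^ 2 ≤ 4 * 16 ^ (k + 1) / q ^ 2 := by gcongr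
      _ = 1600 * (4 ^ k * (k : ℝ) ^ 4) := by
        have e16 : (16 : ℝ) ^ k = 4 ^ k * (2 ^ k * 2 ^ k) := by
          rw [← mul_pow, ← mul_pow]
          norm_num
        rw [hq, pow_succ, e16]
        field_simp
        norm_num
  have h4 : (4 : ℝ) ^ k * k ≤ 4 ^ k * k ^ 4 := by
    gcongr
    exact le_self_pow₀ hk1 (by norm_num)
  linarith

/-- With 16^k ≤ n < 16^(k+1), one has 4^k ≤ √n and k ≤ log n. -/
theorem abs_log_returnProb_stepLaw_le_sqrt {n : ℕ} (hn : 16 ^ 3 ≤ n) :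
    |Real.log (RandomWalk.returnProb stepLaw (2 * n))| ≤
      1640 * (Real.sqrt n * Real.log n ^ 4) := by
  set k := Nat.log 16 n with hk
  have hn0 : n ≠ 0 := by
    rintro rfl
    norm_num at hn
  have h1 : 16 ^ k ≤ n := Nat.pow_log_le_self 16 hn0
  have h2 : n < 16 ^ (k + 1) := Nat.lt_pow_succ_log_self (by norm_num) n
  have hk3 : 3 ≤ k := (Nat.le_log_iff_pow_le (by norm_num) hn0).2 hn
  refine (abs_log_returnProb_stepLaw_le hk3 h2.le).trans ?_
  have h1' : (16 : ℝ) ^ k ≤ n := by exact_mod_cast h1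
  have h4 : (4 : ℝ) ^ k ≤ Real.sqrt n := by
    refine Real.le_sqrt_of_sq_le ?_
    rw [← pow_mul, mul_comm, pow_mul]
    norm_num
    exact h1'
  have h5 : (k : ℝ) ≤ Real.log n := by
    have := Real.log_le_log (by positivity) h1'
    rw [Real.log_pow, show (16 : ℝ) = 2 ^ 4 by norm_num, Real.log_pow] at this
    have h6 := Real.log_two_gt_d9
    have h7 : (0 : ℝ) ≤ k := Nat.cast_nonneg k
    push_cast at this
    nlinarith
  gcongr

theorem upperReturnExponent_stepLaw_le :
    RandomWalk.upperReturnExponent stepLaw ≤ ((1 / 2 : ℝ) : EReal) := by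
  have hlog : Filter.Tendsto (fun n : ℕ => Real.log n) Filter.atTop Filter.atTop :=
    Real.tendsto_log_atTop.comp tendsto_natCast_atTop_atTop
  have hloglog : Filter.Tendsto (fun n : ℕ => Real.log (Real.log n) / Real.log n) Filter.atTop
      (nhds 0) := Real.isLittleO_log_id_atTop.tendsto_div_nhds_zero.comp hlog
  have hlim : Filter.Tendsto (fun n : ℕ => Real.log 1640 / Real.log n + 1 / 2 +
      4 * (Real.log (Real.log n) / Real.log n)) Filter.atTop (nhds (1 / 2)) := by
    have h := ((hlog.const_div_atTop (Real.log 1640)).add_const (1 / 2)).add (hloglog.const_mul 4)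
    simpa using h
  rw [RandomWalk.upperReturnExponent]
  refine (Filter.limsup_le_limsup ?_).trans_eq
    ((continuous_coe_real_ereal.tendsto (1 / 2 : ℝ)).comp hlim).limsup_eq
  filter_upwards [Filter.eventually_ge_atTop (16 ^ 3), hlog.eventually_ge_atTop 1] with n hn hn1
  refine EReal.coe_le_coe_iff.2 ?_
  have h0 : 0 < Real.log n := by linarith
  have hn0 : (1 : ℝ) ≤ n := by
    have : 1 ≤ n := le_trans (by norm_num) hn
    exact_mod_cast this
  have hs : 1 ≤ Real.sqrt n := Real.one_le_sqrt.2 hn0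
  have hb : Real.log (1640 * (Real.sqrt n * Real.log n ^ 4)) =
      Real.log 1640 + (Real.log n / 2 + 4 * Real.log (Real.log n)) := by
    rw [Real.log_mul (by norm_num) (by positivity), Real.log_mul (by positivity) (by positivity),
      Real.log_sqrt (by positivity), Real.log_pow]
    norm_num
  have hle : Real.log |Real.log (RandomWalk.returnProb stepLaw (2 * n))| ≤
      Real.log 1640 + (Real.log n / 2 + 4 * Real.log (Real.log n)) := by
    rw [← hb]
    have h := abs_log_returnProb_stepLaw_le_sqrt hn
    rcases (abs_nonneg (Real.log (RandomWalk.returnProb stepLaw (2 * n)))).eq_or_lt with e | e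
    -- If the return probability had logarithm 0, the outer logarithm would be 0 by convention, so
    -- the bound must be shown nonnegative.
    · rw [← e, Real.log_zero]
      refine Real.log_nonneg ?_
      have : (1 : ℝ) ≤ Real.log n ^ 4 := one_le_pow₀ hn1
      nlinarith
    · exact Real.log_le_log e h
  rw [div_le_iff₀ h0]
  refine hle.trans_eq ?_
  field_simp
  ring

end Bubble

end

theorem theorem1 :
    Group.FG Bubble.G ∧
      (∀ g : Bubble.G, Bubble.stepLaw g⁻¹ = Bubble.stepLaw g) ∧
      Bubble.stepLaw.support.Finite ∧
      Subgroup.closure Bubble.stepLaw.support = ⊤ ∧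
      ¬ RandomWalk.Liouville Bubble.stepLaw ∧
      RandomWalk.PositiveSpeed Bubble.stepLaw ∧
      RandomWalk.upperReturnExponent Bubble.stepLaw ≤ ((1 / 2 : ℝ) : EReal) := by
  obtain ⟨U, hU⟩ := Bubble.exists_sum_scaling_le
  have hlaw : Bubble.stepLaw = (PMF.uniformOfFintype (ZMod 2 × Fin 4 × ZMod 2)).map
      (Bubble.step Bubble.one_le_scaling) := Bubble.switchWalkSwitch_eq_map _
  have hcl := Bubble.closure_range_step Bubble.one_le_scaling
  have hfin := Set.finite_range (Bubble.step Bubble.one_le_scaling)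
  refine ⟨Group.fg_iff.2 ⟨_, hcl, hfin⟩, ?_, ?_, ?_, ?_, ?_,
    Bubble.upperReturnExponent_stepLaw_le⟩
  · rw [hlaw]
    exact Bubble.map_step_symm _
  · rw [hlaw, Bubble.support_map_step]
    exact hfin
  · rw [hlaw, Bubble.support_map_step]
    exact hcl
  · rw [hlaw]
    exact Bubble.not_liouville _ hU
  · rw [hlaw]
    exact Bubble.positiveSpeed _ hU
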